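/- A \emph{graph database} over a finite set $\sigma$ of binary relation symbols is a finite relational structure $D$ over $\sigma$, that is, a finite directed graph with edges labelled by $\sigma$ (isolated nodes are allowed); node names are taken from a fixed countably infinite set. A (binary) \emph{query} $R$ over $\sigma$ maps each graph database $D$ over $\sigma$ to a binary relation $R(D)$ on the nodes of $D$, compatibly with isomorphisms. A \emph{regular path query} (RPQ) $Q$ over $\sigma$ is given by a regular expression over the alphabet $\sigma$ with language $L(Q)$; $Q(D)$ consists of all pairs $(x,y)$ of nodes such that $D$ contains a directed path (possibly of length $0$) from $x$ to $y$ whose label belongs to $L(Q)$. An \emph{RPQ view} $V=\{V_1,\dots,V_t\}$ consists of finitely many RPQs over $\sigma$; $V(D)$ is the graph database over the schema $\tau=\{V_1,\dots,V_t\}$ in which each symbol $V_i$ is interpreted as $V_i(D)$, and whose nodes are those occurring in at least one of these relations. The view $V$ \emph{determines} $Q$ if, for all graph databases $D,D'$ over $\sigma$, $V(D)=V(D')$ implies $Q(D)=Q(D')$. A \emph{rewriting} of $Q$ using $V$ is a query $R$ over $\tau$ such that $R(V(D))=Q(D)$ for every graph database $D$ over $\sigma$. A query $R$ over $\tau$ has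 NP (respectively coNP) \emph{data complexity} if the following problem, for this fixed $R$, is in NP (respectively coNP): given a graph database $S$ over $\tau$ (an arbitrary one, not necessarily of the form $V(D)$) and nodes $x,y$ of $S$, decide whether $(x,y)\in R(S)$. \textbf{Corollary.} Let $V$ be an RPQ view from $\sigma$ to $\tau$ and let $Q$ be an RPQ over $\sigma$ such that $V$ determines $Q$. Then there exists a rewriting of $Q$ using $V$ with NP data complexity, and there exists a rewriting of $Q$ using $V$ with coNP data complexity. -/

import Mathlib

/-! ### Graph databases, queries and views -/

/-- A graph database over the binary schema `σ`: a finite set of nodes (named by natural numbers)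
and, for every symbol of `σ`, a binary relation on the nodes. Isolated nodes are allowed. -/
@[ext]
structure GraphDB (σ : Type) where
  nodes : Finset ℕ
  edge : σ → ℕ → ℕ → Prop
  edge_left : ∀ a x y, edge a x y → x ∈ nodes
  edge_right : ∀ a x y, edge a x y → y ∈ nodes

namespace GraphDB

variable {σ : Type}

/-- `D.Path x w y`: there is a path in `D` from the node `x` to the node `y` labelled `w`. -/
inductive Path (D : GraphDB σ) : ℕ → List σ → ℕ → Prop
  | nil {x : ℕ} (hx : x ∈ D.nodes) : Path D x [] x
  | cons {a : σ} {x y z : ℕ} {w : List σ} (h : D.edge a x y) (p : Path D y w z) :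
      Path D x (a :: w) z

/-- The isomorphic copy of `D` in which every node `x` is renamed to `π x`. -/
def rename (π : Equiv.Perm ℕ) (D : GraphDB σ) : GraphDB σ where
  nodes := D.nodes.map π.toEmbedding
  edge a x y := D.edge a (π.symm x) (π.symm y)
  edge_left a x y h := by
    simpa [Finset.mem_map_equiv] using D.edge_left a _ _ h
  edge_right a x y h := by
    simpa [Finset.mem_map_equiv] using D.edge_right a _ _ h

theorem Path.left_mem {D : GraphDB σ} {x y : ℕ} {w : List σ} (p : D.Path x w y) :
    x ∈ D.nodes := by
  cases p with
  | nil hx => exact hx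
  | cons h _ => exact D.edge_left _ _ _ h

theorem Path.right_mem {D : GraphDB σ} {x y : ℕ} {w : List σ} (p : D.Path x w y) :
    y ∈ D.nodes := by
  induction p with
  | nil hx => exact hx
  | cons _ _ ih => exact ih

theorem Path.rename {D : GraphDB σ} {x y : ℕ} {w : List σ} (π : Equiv.Perm ℕ)
    (p : D.Path x w y) : (D.rename π).Path (π x) w (π y) := by
  induction p with
  | nil hx => exact .nil (by simpa [GraphDB.rename, Finset.mem_map_equiv] using hx)
  | cons h _ ih => exact .cons (by simpa [GraphDB.rename] using h) ih

theorem rename_symm_rename (π : Equiv.Perm ℕ) (D : GraphDB σ) :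
    (D.rename π).rename π.symm = D := by
  ext
  · simp [GraphDB.rename, Finset.mem_map_equiv]
  · simp [GraphDB.rename]

theorem path_rename_iff {D : GraphDB σ} {x y : ℕ} {w : List σ} (π : Equiv.Perm ℕ) :
    (D.rename π).Path (π x) w (π y) ↔ D.Path x w y := by
  refine ⟨fun p => ?_, fun p => p.rename π⟩
  have q := p.rename π.symm
  rw [rename_symm_rename] at q
  simpa using q

end GraphDB

/-- A binary query over the schema `σ`: a mapping that associates to each graph database `D` a
relation over the nodes of `D`. As usual for queries, the answer may depend on the database only
up to isomorphism, that is, it commutes with renaming the nodes. -/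
structure BinaryQuery (σ : Type) where
  ans : GraphDB σ → Set (ℕ × ℕ)
  ans_mem : ∀ D x y, (x, y) ∈ ans D → x ∈ D.nodes ∧ y ∈ D.nodes
  ans_rename : ∀ (π : Equiv.Perm ℕ) D x y, (π x, π y) ∈ ans (D.rename π) ↔ (x, y) ∈ ans D

/-- The regular path query given by a regular expression `e` selects the pairs of nodes
that are connected by a path whose label belongs to the language of `e`. -/
def rpq {σ : Type} (e : RegularExpression σ) : BinaryQuery σ where
  ans D := {p | ∃ w ∈ e.matches', D.Path p.1 w p.2}
  ans_mem := by
    rintro D x y ⟨w, _, p⟩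
    exact ⟨p.left_mem, p.right_mem⟩
  ans_rename π D x y := by
    simp [GraphDB.path_rename_iff]

/-- A view from `σ` to the schema `τ` consists of one query over `σ` for each symbol of `τ`. -/
abbrev View (σ τ : Type) : Type := τ → BinaryQuery σ

open Classical in
/-- The graph database `V(D)`: each symbol `i` of `τ` is instantiated as `Vᵢ(D)`, and the nodes
are those that occur in some of these relations. -/
noncomputable def View.image {σ τ : Type} (V : View σ τ) (D : GraphDB σ) : GraphDB τ where
  nodes := D.nodes.filter fun x => ∃ i y, (x, y) ∈ (V i).ans D ∨ (y, x) ∈ (V i).ans D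
  edge i x y := (x, y) ∈ (V i).ans D
  edge_left i x y h := Finset.mem_filter.2 ⟨((V i).ans_mem D x y h).1, i, y, Or.inl h⟩
  edge_right i x y h := Finset.mem_filter.2 ⟨((V i).ans_mem D x y h).2, i, x, Or.inr h⟩

/-- The view `V` determines the query `Q`. -/
def View.Determines {σ τ : Type} (V : View σ τ) (Q : BinaryQuery σ) : Prop :=
  ∀ D D' : GraphDB σ, V.image D = V.image D' → Q.ans D = Q.ans D'

/-- The query `R` over `τ` is a rewriting of `Q` using `V`. -/
def IsRewriting {σ τ : Type} (R : BinaryQuery τ) (V : View σ τ) (Q : BinaryQuery σ) : Prop :=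
  ∀ D : GraphDB σ, R.ans (V.image D) = Q.ans D

/-! ### Nondeterministic Turing machines, NP and coNP -/

/-- The move of a head: one cell to the left, none, or one cell to the right. -/
inductive HeadMove
  | left
  | stay
  | right

/-- The displacement of a head. -/
def HeadMove.shift : HeadMove → ℤ
  | .left => -1
  | .stay => 0
  | .right => 1

/-- A nondeterministic Turing machine with input alphabet `Bool` and `workTapes + 1` two-way
infinite tapes; tape `0` initially holds the input. `trans q s` is the set of instructions
(new state; symbol to write and head move on every tape) that are applicable in state `q` when the
heads read the symbols `s`. -/
structure NTM where
  State : Type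
  Symbol : Type
  [finiteState : Finite State]
  [finiteSymbol : Finite Symbol]
  workTapes : ℕ
  blank : Symbol
  input : Bool → Symbol
  input_injective : Function.Injective input
  input_ne_blank : ∀ b, input b ≠ blank
  start : State
  accept : State
  trans : State → (Fin (workTapes + 1) → Symbol) →
    Set (State × (Fin (workTapes + 1) → Symbol × HeadMove))

namespace NTM

/-- A configuration: the state, the position of every head, and the contents of every tape. -/
@[ext]
structure Cfg (M : NTM) where
  state : M.State
  head : Fin (M.workTapes + 1) → ℤ
  tape : Fin (M.workTapes + 1) → ℤ → M.Symbol

/-- The initial configuration on the input word `w`: it is written on tape `0` from cell `0`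
onwards, all other cells are blank, and all heads are on cell `0`. -/
def init (M : NTM) (w : List Bool) : M.Cfg where
  state := M.start
  head _ := 0
  tape i z := if i = 0 ∧ 0 ≤ z then (w[z.toNat]?).elim M.blank M.input else M.blank

/-- One step of the machine. -/
def Step (M : NTM) (c c' : M.Cfg) : Prop :=
  ∃ r ∈ M.trans c.state (fun i => c.tape i (c.head i)),
    c' = { state := r.1
           head := fun i => c.head i + (r.2 i).2.shift
           tape := fun i => Function.update (c.tape i) (c.head i) (r.2 i).1 }

/-- `M.Reaches n c c'`: some computation of exactly `n` steps leads from `c` to `c'`. -/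
inductive Reaches (M : NTM) : ℕ → M.Cfg → M.Cfg → Prop
  | refl (c : M.Cfg) : Reaches M 0 c c
  | step {n : ℕ} {c c' c'' : M.Cfg} (h : M.Step c c') (r : Reaches M n c' c'') :
      Reaches M (n + 1) c c''

/-- Some computation of `M` on input `w` accepts after exactly `n` steps. -/
def AcceptsIn (M : NTM) (w : List Bool) (n : ℕ) : Prop :=
  ∃ c, M.Reaches n (M.init w) c ∧ c.state = M.accept

end NTM

/-- The decision problem `P`, whose instances are presented to machines through the encoding
`enc`, is in NP: some nondeterministic Turing machine accepts exactly the yes-instances, and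
accepts each of them within a number of steps polynomial in the length of its encoding. -/
def InNP {α : Type} (enc : α → List Bool) (P : α → Prop) : Prop :=
  ∃ (M : NTM) (p : Polynomial ℕ), ∀ a : α,
    (P a ↔ ∃ n, M.AcceptsIn (enc a) n) ∧
    (P a → ∃ n ≤ p.eval (enc a).length, M.AcceptsIn (enc a) n)

/-- The decision problem `P` is in coNP: its complement is in NP. -/
def InCoNP {α : Type} (enc : α → List Bool) (P : α → Prop) : Prop :=
  InNP enc fun a => ¬ P a

/-! ### Data complexity -/

/-- An instance of the evaluation problem of a fixed query over a schema with `t` symbols: a graph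
database with nodes `0, …, n - 1` and a pair of nodes. (Up to isomorphism, every graph database
with a pair of nodes is of this form.) -/
structure EvalInstance (t : ℕ) where
  n : ℕ
  rel : Fin n → Fin n → Fin t → Bool
  x : Fin n
  y : Fin n

namespace EvalInstance

variable {t : ℕ}

/-- The graph database of an instance. -/
def db (I : EvalInstance t) : GraphDB (Fin t) where
  nodes := Finset.range I.n
  edge a u v := ∃ i j : Fin I.n, u = i ∧ v = j ∧ I.rel i j a = true
  edge_left := by
    rintro a _ _ ⟨i, j, rfl, rfl, _⟩
    simp
  edge_right := by
    rintro a _ _ ⟨i, j, rfl, rfl, _⟩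
    simp

/-- The number `m` in unary, terminated by `false`. -/
def unary (m : ℕ) : List Bool := List.replicate m true ++ [false]

/-- The binary encoding of an instance: the number of nodes and the two distinguished nodes in
unary, followed by the adjacency matrix, row by row, with `t` bits (one per symbol) per entry. -/
def encode (I : EvalInstance t) : List Bool :=
  unary I.n ++ unary I.x ++ unary I.y ++
    (List.finRange I.n).flatMap fun i => (List.finRange I.n).flatMap fun j =>
      (List.finRange t).map fun a => I.rel i j a

end EvalInstance

/-- The evaluation problem of the query `R`: is the given pair of nodes an answer of `R` on the
given graph database? -/
def BinaryQuery.Eval {t : ℕ} (R : BinaryQuery (Fin t)) (I : EvalInstance t) : Prop :=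
  ((I.x : ℕ), (I.y : ℕ)) ∈ R.ans I.db

/-- The query `R` has NP data complexity. -/
def BinaryQuery.NPDataComplexity {t : ℕ} (R : BinaryQuery (Fin t)) : Prop :=
  InNP EvalInstance.encode R.Eval

/-- The query `R` has coNP data complexity. -/
def BinaryQuery.CoNPDataComplexity {t : ℕ} (R : BinaryQuery (Fin t)) : Prop :=
  InCoNP EvalInstance.encode R.Eval

/-! Given `S` and a pair `(x, y)`, consider all databases `D` that realise `S`, that is, whose view
answers are exactly the edges of `S`. One query asks that some such `D` has `(x, y)` as an answer of
`Q`, the other that no such `D` has it as a non-answer. If `V` determines `Q` and `S` is a view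
image, all these `D` agree on `Q`, so both queries are rewritings (`isRewriting_realizationQuery`).
On an `S` that no `D` realises, the first selects nothing and the second everything, which is
harmless. The complexity bounds follow once it is in NP whether some `D` realises `S` and gives `(x,
y)` a prescribed truth value for `Q`.

The obstacle is that `D` can be arbitrarily large; a small model argument (`exists_blocks_realizes`)
removes it. Fix one finite automaton for all views and `Q`. Every node `i` of `S` gets a block
consisting of `i` and one node for each type of nodes `z` of `D` outside `S`. The type records the
state changes along paths from `i` to `z` and the states in which `z` is reached from outside `S`.
Edges are inherited from representatives, but a block can be entered only at its node of `S`. A path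
that starts in `S` thus stays in the block of the node of `S` visited last, and the type of its
current node yields, for every representative, a path of `D` reaching the same automaton state
(`exists_path_of_block_path`). Conversely, paths of `D` between nodes of `S` survive the compression
(`Path.compress`). The compressed database has `n * (K + 1)` nodes, where `K` depends only on `V`
and `Q`.

A certificate is therefore an `n × n` matrix of edge sets taken from a fixed finite set. It is
verified by saturating, in repeated sweeps over the matrix, the sets of reachable nodes and
automaton states (`mem_reach_iff`) and comparing the result with `S` (`consistent_iff_realizes`).
These sets only grow and have `O(n²)` elements in total, which bounds the number of sweeps. An
explicit six-tape machine performs the iteration; `inNP_of_sweeps` hides it behind a combinatorial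
criterion. -/

/-! ### Regular expressions and automata -/

namespace Language

open scoped Computability

variable {α : Type}

/-- Regularity means finitely many left quotients. The quotient of `L * M` by `x` consists of
`(x⁻¹L) * M` and of all `b⁻¹M` for splittings `x = ab` with `a ∈ L`, so it is determined by one
quotient of `L` and a set of quotients of `M`. -/
theorem IsRegular.mul {L M : Language α} (hL : L.IsRegular) (hM : M.IsRegular) :
    (L * M).IsRegular := by
  rw [isRegular_iff_finite_range_leftQuotient] at *
  refine ((hL.prod hM.powerset).image
    (fun p : Language α × Set (Language α) => ({y | y ∈ p.1 * M ∨ ∃ K ∈ p.2, y ∈ K} :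
      Language α))).subset ?_
  rintro _ ⟨x, rfl⟩
  refine ⟨(L.leftQuotient x, {K | ∃ a b, a ++ b = x ∧ a ∈ L ∧ M.leftQuotient b = K}),
    ⟨⟨x, rfl⟩, ?_⟩, ?_⟩
  · rintro _ ⟨a, b, -, -, rfl⟩
    exact ⟨b, rfl⟩
  · ext y
    change (y ∈ L.leftQuotient x * M ∨
      ∃ K ∈ {K | ∃ a b, a ++ b = x ∧ a ∈ L ∧ M.leftQuotient b = K}, y ∈ K) ↔ x ++ y ∈ L * M
    constructor
    · rintro (h | ⟨_, ⟨a, b, rfl, ha, rfl⟩, hy⟩)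
      · obtain ⟨a, ha, b, hb, rfl⟩ := mem_mul.1 h
        exact mem_mul.2 ⟨x ++ a, ha, b, hb, by simp⟩
      · exact mem_mul.2 ⟨a, ha, b ++ y, hy, by simp⟩
    · intro h
      obtain ⟨a, ha, b, hb, hab⟩ := mem_mul.1 h
      rcases List.append_eq_append_iff.1 hab with ⟨c, rfl, rfl⟩ | ⟨c, rfl, rfl⟩
      · exact Or.inr ⟨_, ⟨a, c, rfl, ha, rfl⟩, hb⟩
      · exact Or.inl (mem_mul.2 ⟨c, ha, b, hb, rfl⟩)

/-- The cut between `x` and `y` falls into one of the factors, and `b` is the part of this factor to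
the left of the cut. If the cut is a boundary between factors, the factor that ends there is chosen,
which keeps `b` nonempty. -/
theorem exists_split_of_append_mem_kstar {L : Language α} {l : List (List α)}
    (hl : ∀ w ∈ l, w ∈ L) {x y : List α} (hx : x ≠ []) (h : x ++ y = l.flatten) :
    ∃ a b, a ++ b = x ∧ b ≠ [] ∧ a ∈ L∗ ∧ y ∈ L.leftQuotient b * L∗ := by
  induction l generalizing x with
  | nil => simp_all
  | cons w l ih =>
    have hw : w ∈ L := hl w (by simp)
    have hl' : ∀ v ∈ l, v ∈ L := fun v hv => hl v (by simp [hv])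
    rw [List.flatten_cons] at h
    have whole : ∀ c, w = x ++ c → y = c ++ l.flatten →
        ∃ a b, a ++ b = x ∧ b ≠ [] ∧ a ∈ L∗ ∧ y ∈ L.leftQuotient b * L∗ := by
      rintro c rfl rfl
      exact ⟨[], x, rfl, hx, nil_mem_kstar _,
        mem_mul.2 ⟨c, hw, _, join_mem_kstar hl', rfl⟩⟩
    rcases List.append_eq_append_iff.1 h with ⟨c, hc, hc'⟩ | ⟨c, rfl, hc⟩
    · exact whole c hc hc'
    · by_cases hc0 : c = []
      · subst hc0
        exact whole [] (by simp) (by simpa using hc.symm)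
      · obtain ⟨a, b, rfl, hb, ha, hy⟩ := ih hl' hc0 hc.symm
        refine ⟨w ++ a, b, by simp, hb, ?_, hy⟩
        obtain ⟨m, rfl, hm⟩ := mem_kstar.1 ha
        exact mem_kstar.2 ⟨w :: m, by simp, by simpa [hw] using hm⟩

/-- For `x ≠ []` the quotient of `L∗` is the union of `(b⁻¹L) * L∗` over the splittings `x = ab`
with `a ∈ L∗` and `b ≠ []`, hence determined by a set of quotients of `L`. The empty word
contributes only `L∗` itself. -/
theorem IsRegular.kstar {L : Language α} (hL : L.IsRegular) : (L∗).IsRegular := by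
  rw [isRegular_iff_finite_range_leftQuotient] at *
  refine ((hL.powerset.image
    (fun p : Set (Language α) => ({y | ∃ K ∈ p, y ∈ K * L∗} : Language α))).union
      (Set.finite_singleton (L∗))).subset ?_
  rintro _ ⟨x, rfl⟩
  by_cases hx : x = []
  · subst hx
    exact Or.inr rfl
  refine Or.inl ⟨{K | ∃ a b, a ++ b = x ∧ b ≠ [] ∧ a ∈ L∗ ∧ L.leftQuotient b = K}, ?_, ?_⟩
  · rintro _ ⟨a, b, -, -, -, rfl⟩
    exact ⟨b, rfl⟩
  · ext y
    change (∃ K ∈ {K | ∃ a b, a ++ b = x ∧ b ≠ [] ∧ a ∈ L∗ ∧ L.leftQuotient b = K},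
      y ∈ K * L∗) ↔ x ++ y ∈ L∗
    constructor
    · rintro ⟨_, ⟨a, b, rfl, -, ha, rfl⟩, hy⟩
      obtain ⟨c, hc, d, hd, rfl⟩ := mem_mul.1 hy
      obtain ⟨m, rfl, hm⟩ := mem_kstar.1 ha
      obtain ⟨m', rfl, hm'⟩ := mem_kstar.1 hd
      refine mem_kstar.2 ⟨m ++ [b ++ c] ++ m', by simp, ?_⟩
      have hbc : b ++ c ∈ L := hc
      intro v hv
      simp only [List.append_assoc, List.cons_append, List.nil_append, List.mem_append,
        List.mem_cons] at hv
      rcases hv with hv | rfl | hv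
      exacts [hm v hv, hbc, hm' v hv]
    · intro h
      obtain ⟨l, hl, hl'⟩ := mem_kstar.1 h
      obtain ⟨a, b, h1, h2, h3, h4⟩ := exists_split_of_append_mem_kstar hl' hx hl
      exact ⟨_, ⟨a, b, h1, h2, h3, rfl⟩, h4⟩

end Language

theorem RegularExpression.isRegular_matches' {α : Type} (e : RegularExpression α) :
    e.matches'.IsRegular := by
  induction e with
  | zero =>
    rw [Language.isRegular_iff_finite_range_leftQuotient]
    refine (Set.finite_singleton (0 : Language α)).subset ?_
    rintro _ ⟨x, rfl⟩
    rfl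
  | epsilon =>
    rw [Language.isRegular_iff_finite_range_leftQuotient]
    refine (Set.toFinite {(0 : Language α), 1}).subset ?_
    rintro _ ⟨x, rfl⟩
    rcases x with _ | ⟨a, x⟩
    · exact Or.inr rfl
    · left
      ext y
      change a :: (x ++ y) ∈ (1 : Language α) ↔ y ∈ (0 : Language α)
      simp [Language.mem_one]
  | char c =>
    rw [Language.isRegular_iff_finite_range_leftQuotient]
    refine (Set.toFinite {(0 : Language α), 1, {[c]}}).subset ?_
    rintro _ ⟨x, rfl⟩
    rcases x with _ | ⟨a, x⟩
    · exact Or.inr (Or.inr rfl)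
    · by_cases h : a = c ∧ x = []
      · obtain ⟨rfl, rfl⟩ := h
        right; left
        ext y
        change ([a] ++ y = [a]) ↔ y ∈ (1 : Language α)
        simp [Language.mem_one]
      · left
        ext y
        change ((a :: x) ++ y = [c]) ↔ y ∈ (0 : Language α)
        simp only [List.cons_append, List.cons.injEq, List.append_eq_nil_iff,
          Language.notMem_zero, iff_false]
        tauto
  | plus P Q hP hQ => exact hP.add hQ
  | comp P Q hP hQ => exact hP.mul hQ
  | star P hP => exact hP.kstar

/-- Finitely many regular expressions are recognised simultaneously by one finite deterministic
automaton with several acceptance conditions. -/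
theorem RegularExpression.exists_common_automaton {α ι : Type} [Finite ι]
    (e : ι → RegularExpression α) :
    ∃ (S : Type) (_ : Finite S) (δ : S → α → S) (s₀ : S) (acc : ι → Set S),
      ∀ i w, w ∈ (e i).matches' ↔ w.foldl δ s₀ ∈ acc i := by
  choose S hS M hM using fun i => (e i).isRegular_matches'
  refine ⟨∀ i, S i, inferInstance, fun s a i => (M i).step (s i) a, fun i => (M i).start,
    fun i => {s | s i ∈ (M i).accept}, fun i w => ?_⟩
  have key : ∀ s : ∀ i, S i, (w.foldl (fun s a i => (M i).step (s i) a) s) i =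
      w.foldl (M i).step (s i) := by
    induction w with
    | nil => intro s; rfl
    | cons a w ih => intro s; simp [ih]
  rw [← hM i, DFA.mem_accepts, Set.mem_ofPred_eq, key]
  rfl

/-! ### Databases realising a given view image -/

namespace GraphDB

variable {σ : Type}

theorem Path.append {D : GraphDB σ} {x y z : ℕ} {v w : List σ} (p : D.Path x v y)
    (q : D.Path y w z) : D.Path x (v ++ w) z := by
  induction p with
  | nil _ => exact q
  | cons h _ ih => exact .cons h (ih q)

theorem Path.snoc {D : GraphDB σ} {x y z : ℕ} {w : List σ} {a : σ} (p : D.Path x w y)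
    (h : D.edge a y z) : D.Path x (w ++ [a]) z :=
  p.append (.cons h (.nil (D.edge_right _ _ _ h)))

theorem Path.exists_of_snoc {D : GraphDB σ} {x z : ℕ} {w : List σ} {a : σ}
    (p : D.Path x (w ++ [a]) z) : ∃ y, D.Path x w y ∧ D.edge a y z := by
  induction w generalizing x with
  | nil =>
    cases p with
    | cons h p =>
      cases p with
      | nil _ => exact ⟨x, .nil (D.edge_left _ _ _ h), h⟩
  | cons b w ih =>
    cases p with
    | cons h p =>
      obtain ⟨y, q, hy⟩ := ih p
      exact ⟨y, .cons h q, hy⟩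

theorem path_nil_iff {D : GraphDB σ} {x y : ℕ} : D.Path x [] y ↔ x = y ∧ x ∈ D.nodes := by
  constructor
  · rintro ⟨h⟩
    exact ⟨rfl, h⟩
  · rintro ⟨rfl, h⟩
    exact .nil h

/-- `D` contains all nodes of `S`, the views have exactly the edges of `S` as answers on `D`, and
`(x, y)` is an answer of `Q` on `D` precisely if `pol` is true. -/
structure Realizes {t : ℕ} (V : Fin t → RegularExpression σ) (Q : RegularExpression σ)
    (S : GraphDB (Fin t)) (x y : ℕ) (pol : Bool) (D : GraphDB σ) : Prop where
  -- An inclusion, since `S` may have isolated nodes, which no view image has. It cannot be dropped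
  -- from the small model argument: the empty path must exist at every node of `S`.
  nodes_subset : S.nodes ⊆ D.nodes
  view_iff : ∀ j u v, (u, v) ∈ (rpq (V j)).ans D ↔ S.edge j u v
  query_iff : (x, y) ∈ (rpq Q).ans D ↔ pol = true

theorem Realizes.rename {t : ℕ} {V : Fin t → RegularExpression σ} {Q : RegularExpression σ}
    {S : GraphDB (Fin t)} {x y : ℕ} {pol : Bool} {D : GraphDB σ} (π : Equiv.Perm ℕ)
    (h : Realizes V Q S x y pol D) :
    Realizes V Q (S.rename π) (π x) (π y) pol (D.rename π) where
  nodes_subset := Finset.map_subset_map.2 h.nodes_subset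
  view_iff j u v := by
    have := (rpq (V j)).ans_rename π D (π.symm u) (π.symm v)
    rw [Equiv.apply_symm_apply, Equiv.apply_symm_apply] at this
    rw [this, h.view_iff]
    rfl
  query_iff := by rw [(rpq Q).ans_rename, h.query_iff]

theorem exists_realizes_rename_iff {t : ℕ} {V : Fin t → RegularExpression σ}
    {Q : RegularExpression σ} {S : GraphDB (Fin t)} {x y : ℕ} {pol : Bool} (π : Equiv.Perm ℕ) :
    (∃ D, Realizes V Q (S.rename π) (π x) (π y) pol D) ↔ ∃ D, Realizes V Q S x y pol D := by
  constructor
  · rintro ⟨D, h⟩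
    have := h.rename π.symm
    rw [rename_symm_rename, Equiv.symm_apply_apply, Equiv.symm_apply_apply] at this
    exact ⟨_, this⟩
  · rintro ⟨D, h⟩
    exact ⟨_, h.rename π⟩

/-- The database with nodes `i + n * k` for `i < n` and `k ≤ K`, where the edges from the `i`-th to
the `j`-th block of `K + 1` nodes are given by `E i j`. -/
def ofBlocks (n K : ℕ) (E : ℕ → ℕ → Set (Fin (K + 1) × σ × Fin (K + 1))) : GraphDB σ where
  nodes := Finset.range (n * (K + 1))
  -- Node `0` of block `i` has the number `i`, so the nodes of an instance keep their names.
  edge c u v := ∃ i < n, ∃ j < n, ∃ k l : Fin (K + 1),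
    u = i + n * k ∧ v = j + n * l ∧ (k, c, l) ∈ E i j
  edge_left := by
    rintro c _ _ ⟨i, hi, j, hj, k, l, rfl, rfl, h⟩
    have := Nat.mul_le_mul_left n (Nat.succ_le_of_lt k.2)
    rw [Finset.mem_range]
    rw [Nat.mul_succ] at this
    omega
  edge_right := by
    rintro c _ _ ⟨i, hi, j, hj, k, l, rfl, rfl, h⟩
    have := Nat.mul_le_mul_left n (Nat.succ_le_of_lt l.2)
    rw [Finset.mem_range]
    rw [Nat.mul_succ] at this
    omega

theorem mem_nodes_ofBlocks {n K : ℕ} {E : ℕ → ℕ → Set (Fin (K + 1) × σ × Fin (K + 1))} {u : ℕ} :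
    u ∈ (ofBlocks n K E).nodes ↔ ∃ i < n, ∃ k : Fin (K + 1), u = i + n * k := by
  constructor
  · intro h
    have h : u < n * (K + 1) := Finset.mem_range.1 h
    have hn : 0 < n := Nat.pos_of_ne_zero (by rintro rfl; simp at h)
    exact ⟨u % n, Nat.mod_lt _ hn, ⟨u / n, Nat.div_lt_of_lt_mul h⟩, (Nat.mod_add_div u n).symm⟩
  · rintro ⟨i, hi, k, rfl⟩
    have := Nat.mul_le_mul_left n (Nat.succ_le_of_lt k.2)
    rw [Nat.mul_succ] at this
    exact Finset.mem_range.2 (by omega)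

theorem block_inj {n K i j : ℕ} {k l : Fin (K + 1)} (hi : i < n) (hj : j < n)
    (h : i + n * k = j + n * l) : i = j ∧ k = l := by
  have h1 := congrArg (· % n) h
  have h2 := congrArg (· / n) h
  have hn : 0 < n := by omega
  simp only [Nat.add_mul_mod_self_left, Nat.mod_eq_of_lt hi, Nat.mod_eq_of_lt hj] at h1
  simp only [Nat.add_mul_div_left _ _ hn, Nat.div_eq_of_lt hi, Nat.div_eq_of_lt hj,
    zero_add] at h2
  exact ⟨h1, Fin.ext h2⟩

theorem edge_ofBlocks {n K i j : ℕ} {E : ℕ → ℕ → Set (Fin (K + 1) × σ × Fin (K + 1))}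
    {k l : Fin (K + 1)} {c : σ} (hi : i < n) (hj : j < n) :
    (ofBlocks n K E).edge c (i + n * k) (j + n * l) ↔ (k, c, l) ∈ E i j := by
  constructor
  · rintro ⟨i', hi', j', hj', k', l', h, h', hE⟩
    obtain ⟨rfl, rfl⟩ := block_inj hi hi' h
    obtain ⟨rfl, rfl⟩ := block_inj hj hj' h'
    exact hE
  · intro h
    exact ⟨i, hi, j, hj, k, l, rfl, rfl, h⟩

/-! ### Small models: compressing a database to types of nodes -/

section SmallModel

variable {S : Type} (δ : S → σ → S) (s₀ : S)

/-- The type of the node `z` relative to `i` and `n`: the state changes caused by the paths from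
`i` to `z`, and the states reached along the paths to `z` that start in a node `≥ n`. -/
def nodeType (D : GraphDB σ) (n i z : ℕ) : Set (S × S) × Set S :=
  ({p | ∃ w, D.Path i w z ∧ w.foldl δ p.1 = p.2},
    {q | ∃ z₀ w, n ≤ z₀ ∧ D.Path z₀ w z ∧ w.foldl δ s₀ = q})

variable {A : Set (Set (S × S) × Set S)} {K : ℕ} (e : A ≃ Fin K)

/-- The node `z` of `D` is represented by the `k`-th node of the block of `i`. -/
def Represents (D : GraphDB σ) (n i : ℕ) (k : Fin (K + 1)) (z : ℕ) : Prop :=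
  (k = 0 ∧ z = i) ∨ (n ≤ z ∧ z ∈ D.nodes ∧ ∃ h : nodeType δ s₀ D n i z ∈ A, k = (e ⟨_, h⟩).succ)

/-- The edges of the compressed version of `D`. -/
def blockEdges (D : GraphDB σ) (n i j : ℕ) : Set (Fin (K + 1) × σ × Fin (K + 1)) :=
  {p | ∃ z z', Represents δ s₀ e D n i p.1 z ∧ Represents δ s₀ e D n j p.2.2 z' ∧
    -- A block can be entered from another block only at its node `0`. The current block thus
    -- remembers the node `< n` visited last, relative to which types are taken.
    D.edge p.2.1 z z' ∧ (p.2.2 ≠ 0 → i = j)}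

variable {δ s₀ e} {D : GraphDB σ} {n : ℕ}

theorem Represents.eq_of_zero {i z : ℕ} (h : Represents δ s₀ e D n i 0 z) : z = i := by
  rcases h with ⟨_, h⟩ | ⟨_, _, _, h⟩
  · exact h
  · exact absurd h.symm (Fin.succ_ne_zero _)

theorem Represents.le_of_ne_zero {i z : ℕ} {k : Fin (K + 1)} (h : Represents δ s₀ e D n i k z)
    (hk : k ≠ 0) :
    n ≤ z ∧ z ∈ D.nodes := by
  rcases h with ⟨h, _⟩ | ⟨h, hD, _⟩
  · exact absurd h hk
  · exact ⟨h, hD⟩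

theorem Represents.nodeType_eq {i z z' : ℕ} {k : Fin (K + 1)} (h : Represents δ s₀ e D n i k z)
    (h' : Represents δ s₀ e D n i k z') :
    nodeType δ s₀ D n i z = nodeType δ s₀ D n i z' := by
  rcases h with ⟨h, rfl⟩ | ⟨_, _, h1, h⟩
  · subst h
    rw [h'.eq_of_zero]
  · rcases h' with ⟨h', _⟩ | ⟨_, _, h2, h'⟩
    · exact absurd (h.symm.trans h') (Fin.succ_ne_zero _)
    · simpa using e.injective (Fin.succ_injective _ (h.symm.trans h'))

theorem Represents.lt_iff {i z : ℕ} {k : Fin (K + 1)} (h : Represents δ s₀ e D n i k z)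
    (hi : i < n) : z < n ↔ k = 0 := by
  constructor
  · intro hz
    by_contra hk
    exact absurd (h.le_of_ne_zero hk).1 (by omega)
  · rintro rfl
    rwa [h.eq_of_zero]

/-- Follow the path in `D`: on reaching a node `< n`, switch to its block; otherwise stay in the
current block and go to the node for the type just reached. As `v < n`, the compressed path ends in
`v` itself. -/
theorem Path.compress {z v i : ℕ} {k : Fin (K + 1)} {w : List σ} (p : D.Path z w v) (hv : v < n)
    (hA : ∀ z ∈ D.nodes, n ≤ z → ∀ i, nodeType δ s₀ D n i z ∈ A)
    (hi : i < n) (h : Represents δ s₀ e D n i k z) :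
    (ofBlocks n K (blockEdges δ s₀ e D n)).Path (i + n * k) w v := by
  induction p generalizing i k with
  | @nil z hz =>
    have hk : k = 0 := (h.lt_iff hi).1 hv
    subst hk
    rw [h.eq_of_zero]
    exact path_nil_iff.2 ⟨by simp, mem_nodes_ofBlocks.2 ⟨i, hi, 0, rfl⟩⟩
  | @cons a z z₂ v w he p ih =>
    rcases lt_or_ge z₂ n with h2 | h2
    · have hr : Represents δ s₀ e D n z₂ (0 : Fin (K + 1)) z₂ := Or.inl ⟨rfl, rfl⟩
      exact .cons ((edge_ofBlocks hi h2).2 ⟨z, z₂, h, hr, he, fun h => absurd rfl h⟩)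
        (ih hv h2 hr)
    · have hr : Represents δ s₀ e D n i _ z₂ :=
        Or.inr ⟨h2, D.edge_right _ _ _ he, hA z₂ (D.edge_right _ _ _ he) h2 i, rfl⟩
      exact .cons ((edge_ofBlocks hi hi).2 ⟨z, z₂, h, hr, he, fun _ => rfl⟩) (ih hv hi hr)

/-- The invariant splits the path at the root `i` of the current block. Since `w₁` does not depend
on the representative `z`, the claim about `w₂` only says that a certain pair of states lies in the
first component of the type of `z`, and all representatives share this type. -/
theorem exists_path_of_block_path {u P : ℕ} {w : List σ}
    (p : (ofBlocks n K (blockEdges δ s₀ e D n)).Path u w P) (hu : u < n) (hD : u ∈ D.nodes) :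
    ∃ i < n, ∃ k : Fin (K + 1), P = i + n * k ∧ (∃ z, Represents δ s₀ e D n i k z) ∧
      ∃ w₁, D.Path u w₁ i ∧ ∀ z, Represents δ s₀ e D n i k z →
        ∃ w₂, D.Path i w₂ z ∧ w₂.foldl δ (w₁.foldl δ s₀) = w.foldl δ s₀ := by
  induction w using List.reverseRecOn generalizing P with
  | nil =>
    obtain ⟨rfl, _⟩ := path_nil_iff.1 p
    refine ⟨u, hu, 0, by simp, ⟨u, Or.inl ⟨rfl, rfl⟩⟩, [], .nil hD, fun z hz => ?_⟩
    rw [hz.eq_of_zero]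
    exact ⟨[], .nil hD, rfl⟩
  | append_singleton w c ih =>
    obtain ⟨y, q, he⟩ := p.exists_of_snoc
    obtain ⟨i, hi, k, rfl, -, w₁, p₁, H⟩ := ih q
    obtain ⟨i', hi', j, hj, k', l, h, rfl, z, z', hz, hz', hc, hij⟩ := he
    obtain ⟨rfl, rfl⟩ := block_inj hi hi' h
    refine ⟨j, hj, l, rfl, ⟨z', hz'⟩, ?_⟩
    dsimp only at hz hz' hc hij
    obtain ⟨w₂, p₂, h₂⟩ := H z hz
    by_cases hl : l = 0
    · subst hl
      obtain rfl := hz'.eq_of_zero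
      refine ⟨w₁ ++ w₂ ++ [c], (p₁.append p₂).snoc hc, fun z'' hz'' => ?_⟩
      rw [hz''.eq_of_zero]
      exact ⟨[], .nil (D.edge_right _ _ _ hc), by simp [h₂]⟩
    · obtain rfl := hij hl
      refine ⟨w₁, p₁, fun z'' hz'' => ?_⟩
      have hm : (w₁.foldl δ s₀, (w ++ [c]).foldl δ s₀) ∈ (nodeType δ s₀ D n i z').1 :=
        ⟨w₂ ++ [c], p₂.snoc hc, by simp [h₂]⟩
      rw [hz'.nodeType_eq hz''] at hm
      exact hm

/-- A path that starts outside the nodes `< n` has no root to build on, so it is followed by means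
of the second component of types. The start node may represent nothing at all, hence the alternative
`w = []`. -/
theorem exists_path_of_block_path_aux {i₀ P : ℕ} {k₀ : Fin (K + 1)} {w : List σ}
    (p : (ofBlocks n K (blockEdges δ s₀ e D n)).Path (i₀ + n * k₀) w P) (hi₀ : i₀ < n)
    (hk₀ : k₀ ≠ 0) :
    ∃ i < n, ∃ k : Fin (K + 1), P = i + n * k ∧
      (w = [] ∨ ∃ z, Represents δ s₀ e D n i k z) ∧
      ∀ z, Represents δ s₀ e D n i k z →
        ∃ z₀ w', n ≤ z₀ ∧ D.Path z₀ w' z ∧ w'.foldl δ s₀ = w.foldl δ s₀ := by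
  induction w using List.reverseRecOn generalizing P with
  | nil =>
    obtain ⟨rfl, _⟩ := path_nil_iff.1 p
    exact ⟨i₀, hi₀, k₀, rfl, Or.inl rfl, fun z hz =>
      ⟨z, [], (hz.le_of_ne_zero hk₀).1, .nil (hz.le_of_ne_zero hk₀).2, rfl⟩⟩
  | append_singleton w c ih =>
    obtain ⟨y, q, he⟩ := p.exists_of_snoc
    obtain ⟨i, hi, k, rfl, -, H⟩ := ih q
    obtain ⟨i', hi', j, hj, k', l, h, rfl, z, z', hz, hz', hc, hij⟩ := he
    obtain ⟨rfl, rfl⟩ := block_inj hi hi' h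
    refine ⟨j, hj, l, rfl, Or.inr ⟨z', hz'⟩, fun z'' hz'' => ?_⟩
    dsimp only at hz hz' hc hij
    obtain ⟨z₀, w', h₀, p₀, h₁⟩ := H z hz
    have hm : (w ++ [c]).foldl δ s₀ ∈ (nodeType δ s₀ D n j z').2 :=
      ⟨z₀, w' ++ [c], h₀, p₀.snoc hc, by simp [h₁]⟩
    rw [hz'.nodeType_eq hz''] at hm
    exact hm

end SmallModel

/-- Whether a view image is realised by some database can be decided by looking at databases in
which there is a bounded number of nodes for every node of the image. -/
theorem exists_blocks_realizes {S : Type} [Finite S] {t : ℕ} (V : Fin t → RegularExpression σ)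
    (Q : RegularExpression σ) {δ : S → σ → S} {s₀ : S} {acc : Option (Fin t) → Set S}
    (hV : ∀ j w, w ∈ (V j).matches' ↔ w.foldl δ s₀ ∈ acc (some j))
    (hQ : ∀ w, w ∈ Q.matches' ↔ w.foldl δ s₀ ∈ acc none) :
    ∃ K : ℕ, ∀ (I : EvalInstance t) (pol : Bool),
      (∃ D, Realizes V Q I.db I.x I.y pol D) →
        ∃ E, Realizes V Q I.db I.x I.y pol (ofBlocks I.n K E) := by
  -- `A` contains all types or none. If some view accepts the empty word, every node of `D` occurs
  -- in the view image, so no types are needed; moreover, additional nodes would be answers of that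
  -- view. In this case `K = 0`.
  let A : Set (Set (S × S) × Set S) := {_τ | ∀ j, [] ∉ (V j).matches'}
  obtain ⟨K, ⟨e⟩⟩ := Finite.exists_equiv_fin A
  refine ⟨K, ?_⟩
  rintro I pol ⟨D, hD⟩
  have hmem : ∀ u < I.n, u ∈ D.nodes := fun u hu => hD.nodes_subset (Finset.mem_range.2 hu)
  have hlt : ∀ j u v, I.db.edge j u v → u < I.n ∧ v < I.n := fun j u v h =>
    ⟨Finset.mem_range.1 (I.db.edge_left j u v h), Finset.mem_range.1 (I.db.edge_right j u v h)⟩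
  have hA : ∀ z ∈ D.nodes, I.n ≤ z → ∀ i, nodeType δ s₀ D I.n i z ∈ A := by
    intro z hz hn i j hj
    have := (hlt j z z ((hD.view_iff j z z).1 ⟨[], hj, .nil hz⟩)).1
    omega
  have down : ∀ u v w, u < I.n → D.Path u w v → v < I.n →
      (ofBlocks I.n K (blockEdges δ s₀ e D I.n)).Path u w v := by
    intro u v w hu p hv
    have := p.compress (k := 0) (e := e) hv hA hu (Or.inl ⟨rfl, rfl⟩)
    simpa using this
  -- `z` represents `P`, and the two coincide as soon as one of them is `< n`. For views this holds
  -- because `z` occurs in an answer on `D`; for `Q` because the end node is `I.y`.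
  have main : ∀ u w P, u < I.n → (ofBlocks I.n K (blockEdges δ s₀ e D I.n)).Path u w P →
      ∃ w' z, D.Path u w' z ∧ w'.foldl δ s₀ = w.foldl δ s₀ ∧ (z < I.n ∨ P < I.n → P = z) := by
    intro u w P hu p
    obtain ⟨i, hi, k, rfl, ⟨z, hz⟩, w₁, p₁, H⟩ := exists_path_of_block_path p hu (hmem u hu)
    obtain ⟨w₂, p₂, h₂⟩ := H z hz
    refine ⟨w₁ ++ w₂, z, p₁.append p₂, by simp [h₂], fun h => ?_⟩
    have hk : k = 0 := by
      rcases h with h | h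
      · exact (hz.lt_iff hi).1 h
      · by_contra hk
        have : 1 ≤ (k : ℕ) := Nat.one_le_iff_ne_zero.2 fun h => hk (Fin.ext h)
        have := Nat.mul_le_mul_left I.n this
        omega
    subst hk
    simp [hz.eq_of_zero]
  refine ⟨blockEdges δ s₀ e D I.n, ?_, fun j u v => ⟨?_, fun h => ?_⟩, ?_⟩
  · intro u hu
    exact mem_nodes_ofBlocks.2 ⟨u, Finset.mem_range.1 hu, 0, by simp⟩
  · rintro ⟨w, hw, p⟩
    obtain ⟨i₀, hi₀, k₀, rfl⟩ := mem_nodes_ofBlocks.1 p.left_mem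
    dsimp only at p
    by_cases hk₀ : k₀ = 0
    · subst hk₀
      simp only [Fin.val_zero, mul_zero, add_zero] at p ⊢
      obtain ⟨w', z, p', h', hz⟩ := main i₀ w v hi₀ p
      have := (hD.view_iff j i₀ z).1 ⟨w', (hV j w').2 (by rw [h']; exact (hV j w).1 hw), p'⟩
      rw [hz (Or.inl (hlt _ _ _ this).2)]
      exact this
    · exfalso
      -- The index `k₀ ≠ 0` shows that `A` is nonempty, which excludes the empty word. A nonempty
      -- word would give a view answer on `D` that starts in a node `≥ I.n`.
      have hA' : [] ∉ (V j).matches' := (e.symm (k₀.pred hk₀)).2 j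
      obtain ⟨i, hi, k, rfl, rfl | ⟨z, hz⟩, H⟩ := exists_path_of_block_path_aux p hi₀ hk₀
      · exact hA' hw
      · obtain ⟨z₀, w', hz₀, p', h'⟩ := H z hz
        have := (hlt _ _ _ ((hD.view_iff j z₀ z).1
          ⟨w', (hV j w').2 (by rw [h']; exact (hV j w).1 hw), p'⟩)).1
        omega
  · obtain ⟨w, hw, p⟩ := (hD.view_iff j u v).2 h
    exact ⟨w, hw, down u v w (hlt _ _ _ h).1 p (hlt _ _ _ h).2⟩
  · rw [← hD.query_iff]
    constructor
    · rintro ⟨w, hw, p⟩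
      obtain ⟨w', z, p', h', hz⟩ := main _ w _ I.x.2 p
      refine ⟨w', (hQ w').2 (by rw [h']; exact (hQ w).1 hw), ?_⟩
      exact (hz (Or.inr I.y.2)).symm ▸ p'
    · rintro ⟨w, hw, p⟩
      exact ⟨w, hw, down _ _ w I.x.2 p I.y.2⟩

end GraphDB

/-! ### Two rewritings -/

section Rewriting

variable {σ : Type} {t : ℕ} (V : Fin t → RegularExpression σ) (Q : RegularExpression σ)

/-- The query that selects a pair if, for `pol = true`, it is an answer of `Q` on some database
with the given view image, and, for `pol = false`, it is not a non-answer of `Q` on some such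
database. -/
def realizationQuery (pol : Bool) : BinaryQuery (Fin t) where
  ans S := {p | p.1 ∈ S.nodes ∧ p.2 ∈ S.nodes ∧
    ((∃ D, GraphDB.Realizes V Q S p.1 p.2 pol D) ↔ pol = true)}
  ans_mem _ _ _ h := ⟨h.1, h.2.1⟩
  ans_rename π S x y := by
    have h : ∀ z, π z ∈ (S.rename π).nodes ↔ z ∈ S.nodes := fun z => by
      simp [GraphDB.rename]
    change (_ ∧ _ ∧ _) ↔ (_ ∧ _ ∧ _)
    rw [h, h, GraphDB.exists_realizes_rename_iff]

variable {V Q}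

theorem View.mem_nodes_image {τ : Type} {V : View σ τ} {D : GraphDB σ} {x : ℕ} :
    x ∈ (V.image D).nodes ↔ ∃ i y, (x, y) ∈ (V i).ans D ∨ (y, x) ∈ (V i).ans D := by
  simp only [View.image, Finset.mem_filter, and_iff_right_iff_imp]
  rintro ⟨i, y, h | h⟩
  · exact ((V i).ans_mem _ _ _ h).1
  · exact ((V i).ans_mem _ _ _ h).2

theorem View.image_congr {τ : Type} {V : View σ τ} {D D' : GraphDB σ}
    (h : ∀ i x y, (x, y) ∈ (V i).ans D ↔ (x, y) ∈ (V i).ans D') : V.image D = V.image D' := by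
  ext x
  · simp only [View.mem_nodes_image, h]
  · exact h _ _ _

/-- A rewriting can only return nodes of `V(D)`, so `Q` must not have other answers. If a node `z`
of an answer did not occur in `V(D)`, it could be swapped with a fresh name: the view image stays
the same, hence so does the answer, but `z` is no longer a node. -/
theorem View.Determines.mem_image_nodes {V : View σ (Fin t)} {Q : BinaryQuery σ}
    (hdet : V.Determines Q) {D : GraphDB σ} {x y : ℕ} (h : (x, y) ∈ Q.ans D) :
    x ∈ (V.image D).nodes ∧ y ∈ (V.image D).nodes := by
  have key : ∀ z, (z = x ∨ z = y) → z ∈ (V.image D).nodes := by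
    intro z hz
    by_contra hn
    obtain ⟨z', hz'⟩ := Infinite.exists_notMem_finset D.nodes
    have hfix : ∀ u v i, (u, v) ∈ (V i).ans D → Equiv.swap z z' u = u ∧ Equiv.swap z z' v = v := by
      intro u v i huv
      have hu : u ∈ (V.image D).nodes := (V.image D).edge_left i u v huv
      have hv : v ∈ (V.image D).nodes := (V.image D).edge_right i u v huv
      have hD := (V i).ans_mem D u v huv
      constructor <;> apply Equiv.swap_apply_of_ne_of_ne
      · rintro rfl; exact hn hu
      · rintro rfl; exact hz' hD.1
      · rintro rfl; exact hn hv
      · rintro rfl; exact hz' hD.2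
    have hedge : ∀ i u v, (u, v) ∈ (V i).ans (D.rename (Equiv.swap z z')) ↔
        (u, v) ∈ (V i).ans D := by
      intro i u v
      constructor
      · intro huv
        have := ((V i).ans_rename (Equiv.swap z z') D (Equiv.swap z z' u)
          (Equiv.swap z z' v)).1 (by simpa using huv)
        have h2 := hfix _ _ _ this
        simp only [Equiv.swap_apply_self] at h2
        rw [← h2.1, ← h2.2] at this
        exact this
      · intro huv
        have := ((V i).ans_rename (Equiv.swap z z') D u v).2 huv
        rwa [(hfix _ _ _ huv).1, (hfix _ _ _ huv).2] at this
    have himg : V.image D = V.image (D.rename (Equiv.swap z z')) :=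
      View.image_congr fun i u v => (hedge i u v).symm
    rw [hdet _ _ himg] at h
    have hzm : z ∈ (D.rename (Equiv.swap z z')).nodes := by
      rcases hz with rfl | rfl
      · exact (Q.ans_mem _ _ _ h).1
      · exact (Q.ans_mem _ _ _ h).2
    simp only [GraphDB.rename, Finset.mem_map_equiv, Equiv.symm_swap, Equiv.swap_apply_left] at hzm
    exact hz' hzm
  exact ⟨key x (Or.inl rfl), key y (Or.inr rfl)⟩

/-- `D` realises its own view image, and by determinacy every other realisation gives the same
answers to `Q`. The existential condition therefore collapses to a statement about `D`. -/
theorem isRewriting_realizationQuery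
    (hdet : View.Determines (fun i => rpq (V i)) (rpq Q)) (pol : Bool) :
    IsRewriting (realizationQuery V Q pol) (fun i => rpq (V i)) (rpq Q) := by
  intro D
  have same : ∀ x y D', GraphDB.Realizes V Q (View.image (fun i => rpq (V i)) D) x y pol D' →
      ((x, y) ∈ (rpq Q).ans D ↔ pol = true) := by
    intro x y D' h
    rw [← h.query_iff, hdet D D']
    exact View.image_congr fun i u v => (h.view_iff i u v).symm
  have self : ∀ x y, ((x, y) ∈ (rpq Q).ans D ↔ pol = true) →
      GraphDB.Realizes V Q (View.image (fun i => rpq (V i)) D) x y pol D := fun x y h =>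
    ⟨fun u hu => by
      obtain ⟨i, v, h | h⟩ := View.mem_nodes_image.1 hu
      exacts [((rpq (V i)).ans_mem _ _ _ h).1, ((rpq (V i)).ans_mem _ _ _ h).2],
      fun _ _ _ => Iff.rfl, h⟩
  have hex : ∀ x y, (∃ D', GraphDB.Realizes V Q (View.image (fun i => rpq (V i)) D) x y pol D') ↔
      ((x, y) ∈ (rpq Q).ans D ↔ pol = true) := fun x y =>
    ⟨fun ⟨D', h⟩ => same x y D' h, fun h => ⟨D, self x y h⟩⟩
  ext ⟨x, y⟩
  change (_ ∧ _ ∧ _) ↔ _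
  rw [hex x y]
  constructor
  · rintro ⟨_, _, h⟩
    by_contra hc
    cases pol <;> simp_all
  · intro h
    have hm := hdet.mem_image_nodes h
    refine ⟨hm.1, hm.2, ?_⟩
    cases pol <;> simp_all

theorem eval_realizationQuery (pol : Bool) (I : EvalInstance t) :
    (realizationQuery V Q pol).Eval I ↔
      ((∃ D, GraphDB.Realizes V Q I.db I.x I.y pol D) ↔ pol = true) := by
  change (_ ∧ _ ∧ _) ↔ _
  have hx : (I.x : ℕ) ∈ I.db.nodes := Finset.mem_range.2 I.x.2
  have hy : (I.y : ℕ) ∈ I.db.nodes := Finset.mem_range.2 I.y.2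
  simp [hx, hy]

end Rewriting

/-! ### A machine for matrix sweeps -/

/-- The local rules of a computation on square matrices: `initCell` builds the initial entry in row `i`
and column `j` from the bits of the input, the truth values of `i = j`, `j = x` and `j = y`, and a
guess; `upd` computes the new entry at `(u, b)` from the entry at `(u, a)`, the initial entry at
`(a, b)` and the current entry at `(u, b)`, and `bad` tells whether these entries are in
conflict. -/
structure SweepSpec (t : ℕ) where
  Cell : Type
  Guess : Type
  [finiteCell : Finite Cell]
  [finiteGuess : Finite Guess]
  noGuess : Guess
  initCell : (Fin t → Bool) → Bool → Bool → Bool → Guess → Cell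
  upd : Cell → Cell → Cell → Cell
  bad : Cell → Cell → Cell → Bool

namespace SweepSpec

variable {t : ℕ} (P : SweepSpec t)

instance : Finite P.Cell := P.finiteCell

instance : Finite P.Guess := P.finiteGuess

noncomputable instance : DecidableEq P.Cell := Classical.decEq _

/-- The tape symbols. The ruler consists of ticks `tick atX atY diag`. -/
inductive Sym
  | blank
  | bit (b : Bool)
  | sep
  | cell (l : P.Cell)
  | guess (g : P.Guess)
  | tick (atX atY diag : Bool)

/-- The machine states. -/
inductive State (t : ℕ)
  | guess
  | ticks (first : Bool)
  | rewind (k : Fin 3)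
  | markX
  | markY
  | build (k : Fin (t + 1)) (v : Fin t → Bool) (pend : Bool)
  | inner (ch bad : Bool)
  | decide (ch bad : Bool)
  | rowBack (ch bad : Bool)
  | matBack (ch bad : Bool)
  | copy
  | halt (acc : Bool)

instance : Finite P.Sym := by
  let f : Option (Bool ⊕ Option (P.Cell ⊕ P.Guess ⊕ Bool × Bool × Bool)) → P.Sym
    | none => .blank
    | some (.inl b) => .bit b
    | some (.inr none) => .sep
    | some (.inr (some (.inl l))) => .cell l
    | some (.inr (some (.inr (.inl g)))) => .guess g
    | some (.inr (some (.inr (.inr p)))) => .tick p.1 p.2.1 p.2.2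
  refine Finite.of_surjective f ?_
  rintro (_ | b | _ | l | g | ⟨a, b, c⟩)
  exacts [⟨none, rfl⟩, ⟨some (.inl b), rfl⟩, ⟨some (.inr none), rfl⟩,
    ⟨some (.inr (some (.inl l))), rfl⟩, ⟨some (.inr (some (.inr (.inl g)))), rfl⟩,
    ⟨some (.inr (some (.inr (.inr (a, b, c))))), rfl⟩]

instance : Finite (State t) := by
  let f : Option (Option (Option (Option Bool))) ⊕ Fin 3 ⊕ Bool ⊕
      (Fin (t + 1) × (Fin t → Bool) × Bool) ⊕ (Fin 4 × Bool × Bool) → State t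
    | .inl none => .guess
    | .inl (some none) => .markX
    | .inl (some (some none)) => .markY
    | .inl (some (some (some none))) => .copy
    | .inl (some (some (some (some b)))) => .halt b
    | .inr (.inl k) => .rewind k
    | .inr (.inr (.inl b)) => .ticks b
    | .inr (.inr (.inr (.inl p))) => .build p.1 p.2.1 p.2.2
    | .inr (.inr (.inr (.inr (k, c, b)))) =>
        ![.inner c b, .decide c b, .rowBack c b, .matBack c b] k
  refine Finite.of_surjective f ?_
  rintro (_ | b | k | _ | _ | ⟨k, v, p⟩ | ⟨c, b⟩ | ⟨c, b⟩ | ⟨c, b⟩ | ⟨c, b⟩ | _ | b)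
  exacts [⟨.inl none, rfl⟩, ⟨.inr (.inr (.inl b)), rfl⟩, ⟨.inr (.inl k), rfl⟩,
    ⟨.inl (some none), rfl⟩, ⟨.inl (some (some none)), rfl⟩,
    ⟨.inr (.inr (.inr (.inl (k, v, p)))), rfl⟩,
    ⟨.inr (.inr (.inr (.inr (0, c, b)))), rfl⟩, ⟨.inr (.inr (.inr (.inr (1, c, b)))), rfl⟩,
    ⟨.inr (.inr (.inr (.inr (2, c, b)))), rfl⟩, ⟨.inr (.inr (.inr (.inr (3, c, b)))), rfl⟩,
    ⟨.inl (some (some (some none))), rfl⟩, ⟨.inl (some (some (some (some b)))), rfl⟩]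

/-- The guess on a symbol of the certificate tape. -/
def Sym.toGuess : P.Sym → P.Guess
  | .guess g => g
  | _ => P.noGuess

/-- An instruction: the new state and the actions on the six tapes, which are the input, the matrix
at the start of the sweep, the initial matrix, the current matrix, the certificate and the
ruler. -/
structure Instr where
  state : State t
  a0 : P.Sym × HeadMove
  a1 : P.Sym × HeadMove
  a2 : P.Sym × HeadMove
  a3 : P.Sym × HeadMove
  a4 : P.Sym × HeadMove
  a5 : P.Sym × HeadMove

/-- The instruction that is executed in the state `q` when the heads read `s0, …, s5`. -/
noncomputable def next (q : State t) (s0 s1 s2 s3 s4 s5 : P.Sym) : P.Instr :=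
  let I : P.Instr :=
    ⟨q, (s0, .stay), (s1, .stay), (s2, .stay), (s3, .stay), (s4, .stay), (s5, .stay)⟩
  match q with
  -- The certificate is written leftwards, so its first symbol is one cell to the right.
  | .guess => { I with state := .ticks true, a4 := (s4, .right) }
  -- The tick written first carries the diagonal mark, as required for row `0`.
  | .ticks first =>
    match s0 with
    | .bit true =>
      { I with state := .ticks false, a0 := (s0, .right), a5 := (.tick false false first, .right) }
    | _ => { I with state := .rewind 0, a0 := (s0, .right), a5 := (s5, .left) }
  | .rewind k =>
    match s5 with
    | .tick _ _ _ => { I with a5 := (s5, .left) }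
    | _ => { I with
        state := ![.markX, .markY, .build 0 (fun _ => false) false] k
        a5 := (s5, .right) }
  | .markX =>
    match s0 with
    | .bit true => { I with a0 := (s0, .right), a5 := (s5, .right) }
    | _ =>
      match s5 with
      | .tick _ y d =>
        { I with state := .rewind 1, a0 := (s0, .right), a5 := (.tick true y d, .left) }
      | _ => I
  | .markY =>
    match s0 with
    | .bit true => { I with a0 := (s0, .right), a5 := (s5, .right) }
    | _ =>
      match s5 with
      | .tick x _ d =>
        { I with state := .rewind 2, a0 := (s0, .right), a5 := (.tick x true d, .left) }
      | _ => I
  -- Writing a row moves the diagonal mark one tick to the right for the next row: each tick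
  -- receives the pending mark of its predecessor, and its own old mark becomes pending.
  | .build k v pend =>
    match s5 with
    | .tick x y d =>
      if h : (k : ℕ) < t then
        match s0 with
        | .bit b =>
          { I with
            state := .build ⟨k + 1, Nat.succ_lt_succ h⟩ (Function.update v ⟨k, h⟩ b) pend
            a0 := (s0, .right) }
        | _ => I
      else
        { I with
          state := .build 0 (fun _ => false) d
          a1 := (.cell (P.initCell v d x y (s4.toGuess)), .right)
          a2 := (.cell (P.initCell v d x y (s4.toGuess)), .right)
          a3 := (.cell (P.initCell v d x y (s4.toGuess)), .right)
          a4 := (s4, .right)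
          a5 := (.tick x y pend, .right) }
    | _ =>
      -- A mark still pending at the end of the ruler has left the last column, so this was the last
      -- row. The state with `ch = true`, together with a first matrix head beyond the matrix,
      -- imitates the end of a sweep with changes; the first sweep thus begins through the ordinary
      -- restart.
      if pend then
        { I with
          state := .matBack true false
          a1 := (.sep, .right)
          a2 := (.sep, .stay)
          a3 := (.sep, .right) }
      else
        { I with
          state := .rewind 2
          a1 := (.sep, .right)
          a2 := (.sep, .right)
          a3 := (.sep, .right)
          a5 := (s5, .left) }
  | .inner ch bad =>
    match s1 with
    | .cell l₁ =>
      match s2, s3 with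
      | .cell l₂, .cell l₃ =>
        { I with
          state := .inner (ch || decide (P.upd l₁ l₂ l₃ ≠ l₃)) (bad || P.bad l₁ l₂ l₃)
          a2 := (s2, .right)
          a3 := (.cell (P.upd l₁ l₂ l₃), .right) }
      | _, _ => { I with state := .decide ch bad, a1 := (s1, .right), a2 := (s2, .right) }
    | _ =>
      -- The sweep is over. Conflicts found in a sweep with changes are discarded, as they are
      -- meaningful only for a stable matrix.
      if ch then { I with state := .copy, a1 := (s1, .left), a3 := (s3, .left) }
      else { I with state := .halt (!bad) }
  -- The head on tape 1 has moved on by one column: a cell means that row `u` continues with this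
  -- column, a separator that row `u` is finished.
  | .decide ch bad =>
    match s1 with
    | .cell _ => { I with state := .rowBack ch bad, a3 := (s3, .left) }
    | _ =>
      { I with
        state := .matBack ch bad
        a1 := (s1, .right)
        a2 := (s2, .left)
        a3 := (s3, .right) }
  | .rowBack ch bad =>
    match s3 with
    | .cell _ => { I with a3 := (s3, .left) }
    | _ => { I with state := .inner ch bad, a3 := (s3, .right) }
  | .matBack ch bad =>
    match s2 with
    | .blank => { I with state := .inner ch bad, a2 := (s2, .right) }
    | _ => { I with a2 := (s2, .left) }
  | .copy =>
    match s3 with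
    | .blank =>
      { I with state := .inner false false, a1 := (s1, .right), a3 := (s3, .right) }
    | _ => { I with a1 := (s3, .left), a3 := (s3, .left) }
  | .halt _ => I

/-- A configuration of the machine. -/
@[ext]
structure Conf where
  q : State t
  h0 : ℤ
  h1 : ℤ
  h2 : ℤ
  h3 : ℤ
  h4 : ℤ
  h5 : ℤ
  T0 : ℤ → P.Sym
  T1 : ℤ → P.Sym
  T2 : ℤ → P.Sym
  T3 : ℤ → P.Sym
  T4 : ℤ → P.Sym
  T5 : ℤ → P.Sym

variable {P}

/-- The instruction to be executed in a configuration. -/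
noncomputable def Conf.instr (c : P.Conf) : P.Instr :=
  P.next c.q (c.T0 c.h0) (c.T1 c.h1) (c.T2 c.h2) (c.T3 c.h3) (c.T4 c.h4) (c.T5 c.h5)

/-- One deterministic step. -/
noncomputable def Conf.step (c : P.Conf) : P.Conf where
  q := c.instr.state
  h0 := c.h0 + c.instr.a0.2.shift
  h1 := c.h1 + c.instr.a1.2.shift
  h2 := c.h2 + c.instr.a2.2.shift
  h3 := c.h3 + c.instr.a3.2.shift
  h4 := c.h4 + c.instr.a4.2.shift
  h5 := c.h5 + c.instr.a5.2.shift
  T0 := Function.update c.T0 c.h0 c.instr.a0.1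
  T1 := Function.update c.T1 c.h1 c.instr.a1.1
  T2 := Function.update c.T2 c.h2 c.instr.a2.1
  T3 := Function.update c.T3 c.h3 c.instr.a3.1
  T4 := Function.update c.T4 c.h4 c.instr.a4.1
  T5 := Function.update c.T5 c.h5 c.instr.a5.1

/-- The configuration `c'` is reached from `c` within `B` deterministic steps. -/
def Reach (B : ℕ) (c c' : P.Conf) : Prop := ∃ m ≤ B, Conf.step^[m] c = c'

theorem Reach.refl (c : P.Conf) : Reach 0 c c := ⟨0, le_rfl, rfl⟩

theorem Reach.trans {A B : ℕ} {c c' c'' : P.Conf} (h : Reach A c c') (h' : Reach B c' c'') :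
    Reach (A + B) c c'' := by
  obtain ⟨a, ha, rfl⟩ := h
  obtain ⟨b, hb, rfl⟩ := h'
  exact ⟨b + a, by omega, Function.iterate_add_apply _ _ _ _⟩

theorem Reach.mono {A B : ℕ} {c c' : P.Conf} (h : Reach A c c') (hAB : A ≤ B) : Reach B c c' := by
  obtain ⟨a, ha, h⟩ := h
  exact ⟨a, ha.trans hAB, h⟩

theorem Reach.single {c c' : P.Conf} (h : c.step = c') : Reach 1 c c' := ⟨1, le_rfl, h⟩

theorem Reach.head {B : ℕ} {c c' c'' : P.Conf} (h : c.step = c') (h' : Reach B c' c'') :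
    Reach (B + 1) c c'' := by
  rw [add_comm]
  exact (Reach.single h).trans h'

/-! #### Single steps -/

theorem step_ticks_bit {c : P.Conf} {f : Bool} (hq : c.q = .ticks f)
    (h0 : c.T0 c.h0 = .bit true) :
    c.step = { c with
      q := .ticks false
      h0 := c.h0 + 1
      h5 := c.h5 + 1
      T5 := Function.update c.T5 c.h5 (.tick false false f) } := by
  simp [Conf.step, Conf.instr, next, hq, h0, HeadMove.shift]

theorem step_ticks_end {c : P.Conf} {f : Bool} (hq : c.q = .ticks f)
    (h0 : c.T0 c.h0 = .bit false) :
    c.step = { c with q := .rewind 0, h0 := c.h0 + 1, h5 := c.h5 - 1 } := by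
  simp [Conf.step, Conf.instr, next, hq, h0, HeadMove.shift, Int.sub_eq_add_neg]

theorem step_rewind_tick {c : P.Conf} {k : Fin 3} {x y d : Bool} (hq : c.q = .rewind k)
    (h5 : c.T5 c.h5 = .tick x y d) : c.step = { c with h5 := c.h5 - 1 } := by
  simp [Conf.step, Conf.instr, next, hq, h5, HeadMove.shift, Int.sub_eq_add_neg]

theorem step_rewind_blank {c : P.Conf} {k : Fin 3} (hq : c.q = .rewind k)
    (h5 : c.T5 c.h5 = .blank) :
    c.step = { c with
      q := ![.markX, .markY, .build 0 (fun _ => false) false] k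
      h5 := c.h5 + 1 } := by
  simp [Conf.step, Conf.instr, next, hq, h5, HeadMove.shift]

theorem step_markX_bit {c : P.Conf} (hq : c.q = .markX) (h0 : c.T0 c.h0 = .bit true) :
    c.step = { c with h0 := c.h0 + 1, h5 := c.h5 + 1 } := by
  simp [Conf.step, Conf.instr, next, hq, h0, HeadMove.shift]

theorem step_markX_end {c : P.Conf} {x y d : Bool} (hq : c.q = .markX)
    (h0 : c.T0 c.h0 = .bit false) (h5 : c.T5 c.h5 = .tick x y d) :
    c.step = { c with
      q := .rewind 1
      h0 := c.h0 + 1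
      h5 := c.h5 - 1
      T5 := Function.update c.T5 c.h5 (.tick true y d) } := by
  simp [Conf.step, Conf.instr, next, hq, h0, h5, HeadMove.shift, Int.sub_eq_add_neg]

theorem step_markY_bit {c : P.Conf} (hq : c.q = .markY) (h0 : c.T0 c.h0 = .bit true) :
    c.step = { c with h0 := c.h0 + 1, h5 := c.h5 + 1 } := by
  simp [Conf.step, Conf.instr, next, hq, h0, HeadMove.shift]

theorem step_markY_end {c : P.Conf} {x y d : Bool} (hq : c.q = .markY)
    (h0 : c.T0 c.h0 = .bit false) (h5 : c.T5 c.h5 = .tick x y d) :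
    c.step = { c with
      q := .rewind 2
      h0 := c.h0 + 1
      h5 := c.h5 - 1
      T5 := Function.update c.T5 c.h5 (.tick x true d) } := by
  simp [Conf.step, Conf.instr, next, hq, h0, h5, HeadMove.shift, Int.sub_eq_add_neg]

theorem step_build_bit {c : P.Conf} {k : Fin (t + 1)} {v : Fin t → Bool} {pend x y d b : Bool}
    (hq : c.q = .build k v pend) (hk : (k : ℕ) < t) (h5 : c.T5 c.h5 = .tick x y d)
    (h0 : c.T0 c.h0 = .bit b) :
    c.step = { c with
      q := .build ⟨k + 1, Nat.succ_lt_succ hk⟩ (Function.update v ⟨k, hk⟩ b) pend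
      h0 := c.h0 + 1 } := by
  simp [Conf.step, Conf.instr, next, hq, h0, h5, hk, HeadMove.shift]

theorem step_build_cell {c : P.Conf} {k : Fin (t + 1)} {v : Fin t → Bool} {pend x y d : Bool}
    (hq : c.q = .build k v pend) (hk : ¬ (k : ℕ) < t) (h5 : c.T5 c.h5 = .tick x y d) :
    c.step = { c with
      q := .build 0 (fun _ => false) d
      h1 := c.h1 + 1
      h2 := c.h2 + 1
      h3 := c.h3 + 1
      h4 := c.h4 + 1
      h5 := c.h5 + 1
      T1 := Function.update c.T1 c.h1 (.cell (P.initCell v d x y (c.T4 c.h4).toGuess))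
      T2 := Function.update c.T2 c.h2 (.cell (P.initCell v d x y (c.T4 c.h4).toGuess))
      T3 := Function.update c.T3 c.h3 (.cell (P.initCell v d x y (c.T4 c.h4).toGuess))
      T5 := Function.update c.T5 c.h5 (.tick x y pend) } := by
  simp [Conf.step, Conf.instr, next, hq, h5, hk, HeadMove.shift]

theorem step_build_row {c : P.Conf} {k : Fin (t + 1)} {v : Fin t → Bool}
    (hq : c.q = .build k v false) (h5 : c.T5 c.h5 = .blank) :
    c.step = { c with
      q := .rewind 2
      h1 := c.h1 + 1
      h2 := c.h2 + 1
      h3 := c.h3 + 1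
      h5 := c.h5 - 1
      T1 := Function.update c.T1 c.h1 .sep
      T2 := Function.update c.T2 c.h2 .sep
      T3 := Function.update c.T3 c.h3 .sep } := by
  simp [Conf.step, Conf.instr, next, hq, h5, HeadMove.shift, Int.sub_eq_add_neg]

theorem step_build_end {c : P.Conf} {k : Fin (t + 1)} {v : Fin t → Bool}
    (hq : c.q = .build k v true) (h5 : c.T5 c.h5 = .blank) :
    c.step = { c with
      q := .matBack true false
      h1 := c.h1 + 1
      h3 := c.h3 + 1
      T1 := Function.update c.T1 c.h1 .sep
      T2 := Function.update c.T2 c.h2 .sep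
      T3 := Function.update c.T3 c.h3 .sep } := by
  simp [Conf.step, Conf.instr, next, hq, h5, HeadMove.shift]

theorem step_inner_cell {c : P.Conf} {ch bad : Bool} {l₁ l₂ l₃ : P.Cell} (hq : c.q = .inner ch bad)
    (h1 : c.T1 c.h1 = .cell l₁) (h2 : c.T2 c.h2 = .cell l₂) (h3 : c.T3 c.h3 = .cell l₃) :
    c.step = { c with
      q := .inner (ch || decide (P.upd l₁ l₂ l₃ ≠ l₃)) (bad || P.bad l₁ l₂ l₃)
      h2 := c.h2 + 1
      h3 := c.h3 + 1
      T3 := Function.update c.T3 c.h3 (.cell (P.upd l₁ l₂ l₃)) } := by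
  simp [Conf.step, Conf.instr, next, hq, h1, h2, h3, HeadMove.shift]

theorem step_inner_sep {c : P.Conf} {ch bad : Bool} {l₁ : P.Cell} (hq : c.q = .inner ch bad)
    (h1 : c.T1 c.h1 = .cell l₁) (h2 : c.T2 c.h2 = .sep) :
    c.step = { c with q := .decide ch bad, h1 := c.h1 + 1, h2 := c.h2 + 1 } := by
  simp [Conf.step, Conf.instr, next, hq, h1, h2, HeadMove.shift]

theorem step_inner_changed {c : P.Conf} {bad : Bool} (hq : c.q = .inner true bad)
    (h1 : c.T1 c.h1 = .blank) :
    c.step = { c with q := .copy, h1 := c.h1 - 1, h3 := c.h3 - 1 } := by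
  simp [Conf.step, Conf.instr, next, hq, h1, HeadMove.shift, Int.sub_eq_add_neg]

theorem step_inner_unchanged {c : P.Conf} {bad : Bool} (hq : c.q = .inner false bad)
    (h1 : c.T1 c.h1 = .blank) : c.step = { c with q := .halt (!bad) } := by
  simp [Conf.step, Conf.instr, next, hq, h1, HeadMove.shift]

theorem step_decide_cell {c : P.Conf} {ch bad : Bool} {l₁ : P.Cell} (hq : c.q = .decide ch bad)
    (h1 : c.T1 c.h1 = .cell l₁) :
    c.step = { c with q := .rowBack ch bad, h3 := c.h3 - 1 } := by
  simp [Conf.step, Conf.instr, next, hq, h1, HeadMove.shift, Int.sub_eq_add_neg]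

theorem step_decide_sep {c : P.Conf} {ch bad : Bool} (hq : c.q = .decide ch bad)
    (h1 : c.T1 c.h1 = .sep) :
    c.step = { c with
      q := .matBack ch bad, h1 := c.h1 + 1, h2 := c.h2 - 1, h3 := c.h3 + 1 } := by
  simp [Conf.step, Conf.instr, next, hq, h1, HeadMove.shift, Int.sub_eq_add_neg]

theorem step_rowBack_cell {c : P.Conf} {ch bad : Bool} {l : P.Cell} (hq : c.q = .rowBack ch bad)
    (h3 : c.T3 c.h3 = .cell l) : c.step = { c with h3 := c.h3 - 1 } := by
  simp [Conf.step, Conf.instr, next, hq, h3, HeadMove.shift, Int.sub_eq_add_neg]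

theorem step_rowBack_end {c : P.Conf} {ch bad : Bool} (hq : c.q = .rowBack ch bad)
    (h3 : c.T3 c.h3 = .sep ∨ c.T3 c.h3 = .blank) :
    c.step = { c with q := .inner ch bad, h3 := c.h3 + 1 } := by
  rcases h3 with h3 | h3 <;> simp [Conf.step, Conf.instr, next, hq, h3, HeadMove.shift]

theorem step_matBack_ne {c : P.Conf} {ch bad : Bool} (hq : c.q = .matBack ch bad)
    (h2 : c.T2 c.h2 ≠ .blank) : c.step = { c with h2 := c.h2 - 1 } := by
  cases h : c.T2 c.h2 <;>
    simp_all [Conf.step, Conf.instr, next, HeadMove.shift, Int.sub_eq_add_neg]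

theorem step_matBack_blank {c : P.Conf} {ch bad : Bool} (hq : c.q = .matBack ch bad)
    (h2 : c.T2 c.h2 = .blank) : c.step = { c with q := .inner ch bad, h2 := c.h2 + 1 } := by
  simp [Conf.step, Conf.instr, next, hq, h2, HeadMove.shift]

theorem step_copy_ne {c : P.Conf} (hq : c.q = .copy) (h3 : c.T3 c.h3 ≠ .blank) :
    c.step = { c with
      h1 := c.h1 - 1, h3 := c.h3 - 1, T1 := Function.update c.T1 c.h1 (c.T3 c.h3) } := by
  cases h : c.T3 c.h3 <;>
    simp_all [Conf.step, Conf.instr, next, HeadMove.shift, Int.sub_eq_add_neg]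

theorem step_copy_blank {c : P.Conf} (hq : c.q = .copy) (h3 : c.T3 c.h3 = .blank) :
    c.step = { c with q := .inner false false, h1 := c.h1 + 1, h3 := c.h3 + 1 } := by
  simp [Conf.step, Conf.instr, next, hq, h3, HeadMove.shift]

theorem step_halt {c : P.Conf} {b : Bool} (hq : c.q = .halt b) : c.step = c := by
  simp [Conf.step, Conf.instr, next, hq, HeadMove.shift, Conf.ext_iff]

/-! #### Loops -/

theorem reach_rewind {c : P.Conf} {k : Fin 3} (m : ℕ) (hq : c.q = .rewind k)
    (h : ∀ i < m, ∃ x y d, c.T5 (c.h5 - i) = .tick x y d) (h' : c.T5 (c.h5 - m) = .blank) :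
    Reach (m + 1) c { c with
      q := ![.markX, .markY, .build 0 (fun _ => false) false] k
      h5 := c.h5 - m + 1 } := by
  induction m generalizing c with
  | zero =>
    rw [Nat.cast_zero, sub_zero] at h'
    refine Reach.single ?_
    rw [step_rewind_blank hq h']
    simp
  | succ m ih =>
    obtain ⟨x, y, d, h0⟩ := h 0 (by omega)
    rw [Nat.cast_zero, sub_zero] at h0
    refine Reach.head (step_rewind_tick hq h0) ?_
    have e : ∀ i : ℕ, c.h5 - 1 - i = c.h5 - (i + 1 : ℕ) := fun i => by push_cast; ring
    have := ih (c := { c with h5 := c.h5 - 1 }) hq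
      (fun i hi => by simpa only [e] using h (i + 1) (by omega)) (by simpa only [e] using h')
    simpa only [e] using this

theorem reach_rowBack {c : P.Conf} {ch bad : Bool} (m : ℕ) (hq : c.q = .rowBack ch bad)
    (h : ∀ i < m, ∃ l, c.T3 (c.h3 - i) = .cell l)
    (h' : c.T3 (c.h3 - m) = .sep ∨ c.T3 (c.h3 - m) = .blank) :
    Reach (m + 1) c { c with q := .inner ch bad, h3 := c.h3 - m + 1 } := by
  induction m generalizing c with
  | zero =>
    rw [Nat.cast_zero, sub_zero] at h'
    refine Reach.single ?_
    rw [step_rowBack_end hq h']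
    simp
  | succ m ih =>
    obtain ⟨l, h0⟩ := h 0 (by omega)
    rw [Nat.cast_zero, sub_zero] at h0
    refine Reach.head (step_rowBack_cell hq h0) ?_
    have e : ∀ i : ℕ, c.h3 - 1 - i = c.h3 - (i + 1 : ℕ) := fun i => by push_cast; ring
    have := ih (c := { c with h3 := c.h3 - 1 }) hq
      (fun i hi => by simpa only [e] using h (i + 1) (by omega)) (by simpa only [e] using h')
    simpa only [e] using this

theorem reach_matBack {c : P.Conf} {ch bad : Bool} (m : ℕ) (hq : c.q = .matBack ch bad)
    (h : ∀ i < m, c.T2 (c.h2 - i) ≠ .blank) (h' : c.T2 (c.h2 - m) = .blank) :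
    Reach (m + 1) c { c with q := .inner ch bad, h2 := c.h2 - m + 1 } := by
  induction m generalizing c with
  | zero =>
    rw [Nat.cast_zero, sub_zero] at h'
    refine Reach.single ?_
    rw [step_matBack_blank hq h']
    simp
  | succ m ih =>
    have h0 := h 0 (by omega)
    rw [Nat.cast_zero, sub_zero] at h0
    refine Reach.head (step_matBack_ne hq h0) ?_
    have e : ∀ i : ℕ, c.h2 - 1 - i = c.h2 - (i + 1 : ℕ) := fun i => by push_cast; ring
    have := ih (c := { c with h2 := c.h2 - 1 }) hq
      (fun i hi => by simpa only [e] using h (i + 1) (by omega)) (by simpa only [e] using h')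
    simpa only [e] using this

/-- `hT` is the loop invariant: tapes 1 and 3 agree outside the `m` cells that remain to be copied.
Copying runs from right to left, which also rewinds both heads. -/
theorem reach_copy {c : P.Conf} (m : ℕ) (hq : c.q = .copy) (h13 : c.h1 = c.h3)
    (h : ∀ i < m, c.T3 (c.h3 - i) ≠ .blank) (h' : c.T3 (c.h3 - m) = .blank)
    (hT : ∀ z, c.h3 < z ∨ z ≤ c.h3 - m → c.T1 z = c.T3 z) :
    Reach (m + 1) c { c with
      q := .inner false false, h1 := c.h3 - m + 1, h3 := c.h3 - m + 1, T1 := c.T3 } := by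
  induction m generalizing c with
  | zero =>
    rw [Nat.cast_zero, sub_zero] at h'
    refine Reach.single ?_
    have hT' : c.T1 = c.T3 := funext fun z => hT z (by rw [Nat.cast_zero]; omega)
    rw [step_copy_blank hq h']
    simp [hT', h13]
  | succ m ih =>
    have h0 := h 0 (by omega)
    rw [Nat.cast_zero, sub_zero] at h0
    refine Reach.head (step_copy_ne hq h0) ?_
    have e : ∀ i : ℕ, c.h3 - 1 - i = c.h3 - (i + 1 : ℕ) := fun i => by push_cast; ring
    have := ih (c := { c with
        h1 := c.h1 - 1, h3 := c.h3 - 1, T1 := Function.update c.T1 c.h1 (c.T3 c.h3) }) hq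
      (by simp [h13]) (fun i hi => by simpa only [e] using h (i + 1) (by omega))
      (by simpa only [e] using h') (by
        intro z hz
        dsimp only at hz ⊢
        by_cases hz' : z = c.h1
        · subst hz'
          simp [h13]
        · rw [Function.update_of_ne hz']
          exact hT z (by push_cast; omega))
    simpa only [e] using this

theorem reach_markX {c : P.Conf} (m : ℕ) (hq : c.q = .markX)
    (h : ∀ i < m, c.T0 (c.h0 + i) = .bit true) :
    Reach m c { c with h0 := c.h0 + m, h5 := c.h5 + m } := by
  induction m with
  | zero => simpa using Reach.refl c
  | succ m ih =>
    refine (ih fun i hi => h i (by omega)).trans (Reach.single ?_)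
    rw [step_markX_bit (c := { c with h0 := c.h0 + m, h5 := c.h5 + m }) hq (h m (by omega))]
    simp [add_assoc]

theorem reach_markY {c : P.Conf} (m : ℕ) (hq : c.q = .markY)
    (h : ∀ i < m, c.T0 (c.h0 + i) = .bit true) :
    Reach m c { c with h0 := c.h0 + m, h5 := c.h5 + m } := by
  induction m with
  | zero => simpa using Reach.refl c
  | succ m ih =>
    refine (ih fun i hi => h i (by omega)).trans (Reach.single ?_)
    rw [step_markY_bit (c := { c with h0 := c.h0 + m, h5 := c.h5 + m }) hq (h m (by omega))]
    simp [add_assoc]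

theorem reach_build_cell {c : P.Conf} {pend x y d : Bool} (s : Fin t → Bool)
    (hq : c.q = .build 0 (fun _ => false) pend) (h5 : c.T5 c.h5 = .tick x y d)
    (h0 : ∀ k : Fin t, c.T0 (c.h0 + k) = .bit (s k)) :
    Reach (t + 1) c { c with
      q := .build 0 (fun _ => false) d
      h0 := c.h0 + t
      h1 := c.h1 + 1
      h2 := c.h2 + 1
      h3 := c.h3 + 1
      h4 := c.h4 + 1
      h5 := c.h5 + 1
      T1 := Function.update c.T1 c.h1 (.cell (P.initCell s d x y (c.T4 c.h4).toGuess))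
      T2 := Function.update c.T2 c.h2 (.cell (P.initCell s d x y (c.T4 c.h4).toGuess))
      T3 := Function.update c.T3 c.h3 (.cell (P.initCell s d x y (c.T4 c.h4).toGuess))
      T5 := Function.update c.T5 c.h5 (.tick x y pend) } := by
  have read : ∀ (k : ℕ) (hk : k < t + 1), Reach k c { c with
      q := .build ⟨k, hk⟩ (fun i => if (i : ℕ) < k then s i else false) pend
      h0 := c.h0 + k } := by
    intro k
    induction k with
    | zero =>
      intro hk
      convert Reach.refl c using 1
      rw [Conf.ext_iff]
      simp [hq]
    | succ k ih =>
      intro hk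
      refine (ih (by omega)).trans (Reach.single ?_)
      have hk' : k < t := Nat.lt_of_succ_lt_succ hk
      rw [step_build_bit (c := { c with
        q := .build ⟨k, by omega⟩ (fun i => if (i : ℕ) < k then s i else false) pend
        h0 := c.h0 + k }) (k := ⟨k, by omega⟩) rfl hk' h5 (h0 ⟨k, hk'⟩)]
      simp only [Conf.mk.injEq, State.build.injEq, true_and, and_true]
      refine ⟨funext fun i => ?_, by push_cast; ring⟩
      by_cases hi : i = ⟨k, hk'⟩
      · subst hi
        simp
      · have hi' : (i : ℕ) ≠ k := fun h => hi (Fin.ext h)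
        rw [Function.update_of_ne hi]
        have : (i : ℕ) < k + 1 ↔ (i : ℕ) < k := by omega
        simp [this]
  refine (read t (by omega)).trans (Reach.single ?_)
  rw [step_build_cell (c := { c with
    q := .build ⟨t, by omega⟩ (fun i => if (i : ℕ) < t then s i else false) pend
    h0 := c.h0 + t }) rfl (lt_irrefl t) h5]
  simp

end SweepSpec

namespace SweepSpec

variable {t : ℕ} {P : SweepSpec t}

/-! #### Tape contents -/

/-- The tape with the symbols `F 0, …, F (N - 1)` from cell `0` onwards. -/
def tape (F : ℕ → P.Sym) (N : ℕ) (z : ℤ) : P.Sym :=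
  if 0 ≤ z ∧ z < N then F z.toNat else .blank

theorem tape_natCast {F : ℕ → P.Sym} {N k : ℕ} (h : k < N) : tape F N k = F k := by
  simp [tape, h]

theorem tape_of_neg {F : ℕ → P.Sym} {N : ℕ} {z : ℤ} (h : z < 0) : tape F N z = .blank :=
  if_neg (by omega)

theorem tape_of_ge {F : ℕ → P.Sym} {N : ℕ} {z : ℤ} (h : N ≤ z) : tape F N z = .blank :=
  if_neg (by omega)

theorem tape_congr {F G : ℕ → P.Sym} {N : ℕ} (h : ∀ k < N, F k = G k) : tape F N = tape G N := by
  funext z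
  unfold tape
  split_ifs with hz
  · exact h _ (by omega)
  · rfl

theorem update_tape {F : ℕ → P.Sym} {N k : ℕ} (h : k < N) (s : P.Sym) :
    Function.update (tape F N) (k : ℤ) s = tape (Function.update F k s) N := by
  funext z
  by_cases hz : z = k
  · subst hz
    simp [tape, h]
  · rw [Function.update_of_ne hz]
    unfold tape
    split_ifs with hz'
    · rw [Function.update_of_ne (by omega)]
    · rfl

theorem update_tape_length {F : ℕ → P.Sym} {N : ℕ} {s : P.Sym} (hs : F N = s) :
    Function.update (tape F N) (N : ℤ) s = tape F (N + 1) := by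
  funext z
  by_cases hz : z = N
  · subst hz
    simp [tape, hs]
  · rw [Function.update_of_ne hz]
    unfold tape
    have : (0 ≤ z ∧ z < (N : ℤ)) ↔ (0 ≤ z ∧ z < ((N + 1 : ℕ) : ℤ)) := by omega
    simp only [this]

/-- The linear position of row `i` and column `j`; the `n`-th column contains separators. -/
def pos (n i j : ℕ) : ℕ := i * (n + 1) + j

theorem pos_div {n i j : ℕ} (hj : j ≤ n) : pos n i j / (n + 1) = i := by
  rw [pos, mul_comm, Nat.mul_add_div (by omega), Nat.div_eq_of_lt (by omega), add_zero]

theorem pos_mod {n i j : ℕ} (hj : j ≤ n) : pos n i j % (n + 1) = j := by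
  rw [pos, mul_comm, Nat.mul_add_mod, Nat.mod_eq_of_lt (by omega)]

theorem pos_lt {n i j : ℕ} (hi : i < n) (hj : j ≤ n) : pos n i j < pos n n 0 := by
  have := Nat.mul_le_mul_right (n + 1) (Nat.succ_le_of_lt hi)
  rw [Nat.succ_mul] at this
  unfold pos
  omega

theorem pos_succ (n i j : ℕ) : pos n i (j + 1) = pos n i j + 1 := rfl

theorem pos_succ_zero (n i : ℕ) : pos n (i + 1) 0 = pos n i n + 1 := by
  unfold pos
  ring

/-- The symbols of a matrix, row by row. -/
def entry (n : ℕ) (A : ℕ → ℕ → P.Cell) (k : ℕ) : P.Sym :=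
  if k % (n + 1) = n then .sep else .cell (A (k / (n + 1)) (k % (n + 1)))

theorem entry_pos {n i j : ℕ} (A : ℕ → ℕ → P.Cell) (hj : j < n) :
    entry n A (pos n i j) = .cell (A i j) := by
  rw [entry, pos_div hj.le, pos_mod hj.le, if_neg hj.ne]

theorem entry_pos_last {n i : ℕ} (A : ℕ → ℕ → P.Cell) : entry n A (pos n i n) = .sep := by
  rw [entry, pos_mod le_rfl, if_pos rfl]

theorem entry_ne_blank (n : ℕ) (A : ℕ → ℕ → P.Cell) (k : ℕ) : entry n A k ≠ .blank := by
  unfold entry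
  split_ifs <;> simp

/-- The tape containing a square matrix. -/
def matTape (n : ℕ) (A : ℕ → ℕ → P.Cell) : ℤ → P.Sym := tape (entry n A) (pos n n 0)

theorem matTape_cell {n i j : ℕ} (A : ℕ → ℕ → P.Cell) (hi : i < n) (hj : j < n) :
    matTape n A (pos n i j) = .cell (A i j) := by
  rw [matTape, tape_natCast (pos_lt hi hj.le), entry_pos A hj]

theorem matTape_sep {n i : ℕ} (A : ℕ → ℕ → P.Cell) (hi : i < n) :
    matTape n A (pos n i n) = .sep := by
  rw [matTape, tape_natCast (pos_lt hi le_rfl), entry_pos_last A]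

theorem matTape_ne_blank {n k : ℕ} (A : ℕ → ℕ → P.Cell) (hk : k < pos n n 0) :
    matTape n A k ≠ .blank := by
  rw [matTape, tape_natCast hk]
  exact entry_ne_blank _ _ _

/-- Replace one entry of a matrix. -/
def setCell {C : Type} (A : ℕ → ℕ → C) (i j : ℕ) (l : C) : ℕ → ℕ → C :=
  Function.update A i (Function.update (A i) j l)

theorem setCell_apply {C : Type} (A : ℕ → ℕ → C) (i j : ℕ) (l : C) (u v : ℕ) :
    setCell A i j l u v = if u = i ∧ v = j then l else A u v := by
  unfold setCell
  by_cases hu : u = i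
  · subst hu
    by_cases hv : v = j
    · subst hv; simp
    · simp [hv]
  · simp [hu]

theorem update_matTape {n i j : ℕ} (A : ℕ → ℕ → P.Cell) (l : P.Cell) (hi : i < n) (hj : j < n) :
    Function.update (matTape n A) (pos n i j : ℤ) (.cell l) = matTape n (setCell A i j l) := by
  rw [matTape, update_tape (pos_lt hi hj.le)]
  refine tape_congr fun k _ => ?_
  by_cases hk : k = pos n i j
  · subst hk
    rw [Function.update_self, entry_pos _ hj, setCell_apply, if_pos ⟨rfl, rfl⟩]
  · rw [Function.update_of_ne hk, entry, entry, setCell_apply]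
    split_ifs with h1 h2
    · rfl
    · exfalso
      refine hk ?_
      rw [pos, ← h2.1, ← h2.2, mul_comm, Nat.div_add_mod]
    · rfl

/-! #### Sweeps -/

/-- Iterate `f 0, …, f (k - 1)`. -/
def loop {α : Type} (f : ℕ → α → α) : ℕ → α → α
  | 0, s => s
  | k + 1, s => f k (loop f k s)

variable (P) in
/-- The state of a sweep: the current matrix, whether it has been changed, and whether a conflict
has been found. -/
abbrev SweepState : Type := (ℕ → ℕ → P.Cell) × Bool × Bool

/-- The action on the triple `(u, a, b)` in a sweep that starts with the matrix `A`. -/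
noncomputable def body (A₀ A : ℕ → ℕ → P.Cell) (u a b : ℕ) (s : P.SweepState) : P.SweepState :=
  (setCell s.1 u b (P.upd (A u a) (A₀ a b) (s.1 u b)),
    s.2.1 || decide (P.upd (A u a) (A₀ a b) (s.1 u b) ≠ s.1 u b),
    s.2.2 || P.bad (A u a) (A₀ a b) (s.1 u b))

/-- The result of a sweep. -/
noncomputable def sweep (n : ℕ) (A₀ A : ℕ → ℕ → P.Cell) : P.SweepState :=
  loop (fun u => loop (fun a => loop (body A₀ A u a) n) n) n (A, false, false)

/-- The configuration at the triple `(u, a, b)` of a sweep. -/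
def sweepConf (c : P.Conf) (n u a b : ℕ) (s : P.SweepState) : P.Conf :=
  { c with
    q := .inner s.2.1 s.2.2
    h1 := pos n u a
    h2 := pos n a b
    h3 := pos n u b
    T3 := matTape n s.1 }

variable {n : ℕ} {A₀ A : ℕ → ℕ → P.Cell} {c : P.Conf}

theorem reach_row (h1 : c.T1 = matTape n A) (h2 : c.T2 = matTape n A₀) {u a : ℕ} (hu : u < n)
    (ha : a < n) (s : P.SweepState) :
    Reach n (sweepConf c n u a 0 s) (sweepConf c n u a n (loop (body A₀ A u a) n s)) := by
  have : ∀ k ≤ n, Reach k (sweepConf c n u a 0 s)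
      (sweepConf c n u a k (loop (body A₀ A u a) k s)) := by
    intro k
    induction k with
    | zero => exact fun _ => Reach.refl _
    | succ k ih =>
      intro hk
      refine (ih (by omega)).trans (Reach.single ?_)
      rw [step_inner_cell (c := sweepConf c n u a k (loop (body A₀ A u a) k s)) rfl
        (by simpa [sweepConf, h1] using matTape_cell A hu ha)
        (by simpa [sweepConf, h2] using matTape_cell A₀ ha (by omega : k < n))
        (by simpa [sweepConf] using matTape_cell _ hu (by omega : k < n))]
      simp only [sweepConf, loop, body]
      rw [update_matTape _ _ hu (by omega)]
      simp [pos_succ]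
  exact this n le_rfl

/-- Only tape 3 is rewound, to the beginning of row `u`; crossing the separator has already put the
head of tape 2 on row `a + 1`. The rewinding stops at the separator of the previous row, or at a
blank if `u = 0`. -/
theorem reach_next_column (h1 : c.T1 = matTape n A) (h2 : c.T2 = matTape n A₀) {u a : ℕ}
    (hu : u < n) (ha : a + 1 < n) (s : P.SweepState) :
    Reach (n + 3) (sweepConf c n u a n s) (sweepConf c n u (a + 1) 0 s) := by
  have ha' : a < n := by omega
  have hs := step_inner_sep (c := sweepConf c n u a n s) rfl
    (by simpa [sweepConf, h1] using matTape_cell A hu ha')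
    (by simpa [sweepConf, h2] using matTape_sep A₀ ha')
  refine Reach.head hs (Reach.head (step_decide_cell (l₁ := A u (a + 1)) rfl ?_) ?_)
  · have := matTape_cell A hu ha
    simpa [sweepConf, h1, pos_succ] using this
  · have e : ∀ i : ℕ, i < n → ((pos n u n : ℕ) : ℤ) - 1 - i = (pos n u (n - 1 - i) : ℕ) := by
      intro i hi
      unfold pos
      push_cast [Nat.sub_sub, Nat.cast_sub (by omega : 1 + i ≤ n)]
      ring
    have := reach_rowBack (c := { sweepConf c n u a n s with
        q := .rowBack s.2.1 s.2.2
        h1 := (pos n u a : ℤ) + 1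
        h2 := (pos n a n : ℤ) + 1
        h3 := (pos n u n : ℤ) - 1 }) n rfl
      (fun i hi => ⟨s.1 u (n - 1 - i), by
        dsimp only [sweepConf]
        rw [e i hi, matTape_cell _ hu (by omega)]⟩) (by
        dsimp only [sweepConf]
        rcases Nat.eq_zero_or_pos u with rfl | hu0
        · right
          refine tape_of_neg ?_
          unfold pos
          push_cast
          omega
        · left
          obtain ⟨v, rfl⟩ : ∃ v, u = v + 1 := ⟨u - 1, by omega⟩
          have : ((pos n (v + 1) n : ℕ) : ℤ) - 1 - n = (pos n v n : ℕ) := by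
            unfold pos; push_cast; ring
          rw [this, matTape_sep _ (by omega)])
    convert this using 1
    · rfl
    · simp only [sweepConf, pos_succ, pos_succ_zero]
      have : ((pos n u 0 : ℕ) : ℤ) = ((pos n u n : ℕ) : ℤ) - 1 - n + 1 := by
        unfold pos; push_cast; ring
      simp [this]

/-- Here tape 2 is rewound completely, which costs `pos n n 0`, whereas the heads on tapes 1 and 3
only cross a separator. -/
theorem reach_next_row (h1 : c.T1 = matTape n A) (h2 : c.T2 = matTape n A₀) {u a : ℕ}
    (hu : u < n) (ha : a + 1 = n) (s : P.SweepState) :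
    Reach (pos n n 0 + 3) (sweepConf c n u a n s) (sweepConf c n (u + 1) 0 0 s) := by
  have ha' : a < n := by omega
  have hs := step_inner_sep (c := sweepConf c n u a n s) rfl
    (by simpa [sweepConf, h1] using matTape_cell A hu ha')
    (by simpa [sweepConf, h2] using matTape_sep A₀ ha')
  refine Reach.head hs (Reach.head (step_decide_sep rfl ?_) ?_)
  · have := matTape_sep A hu
    rw [← ha] at this
    rw [← ha]
    simpa [sweepConf, h1, pos_succ, ← ha] using this
  · have e : ∀ i : ℕ, i < pos n n 0 →
        ((pos n a n : ℕ) : ℤ) + 1 - 1 - i = (pos n n 0 - 1 - i : ℕ) := by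
      intro i hi
      have h := pos_succ_zero n a
      rw [ha] at h
      omega
    have := reach_matBack (c := { sweepConf c n u a n s with
        q := .matBack s.2.1 s.2.2
        h1 := (pos n u a : ℤ) + 1 + 1
        h2 := (pos n a n : ℤ) + 1 - 1
        h3 := (pos n u n : ℤ) + 1 }) (pos n n 0) rfl
      (fun i hi => by
        dsimp only [sweepConf]
        rw [e i hi, h2]
        exact matTape_ne_blank _ (by omega)) (by
        dsimp only [sweepConf]
        rw [h2]
        refine tape_of_neg ?_
        have h := pos_succ_zero n a
        rw [ha] at h
        omega)
    convert this using 1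
    · rfl
    · simp only [sweepConf, pos_succ_zero]
      have h := pos_succ_zero n a
      rw [ha] at h
      have e1 : ((pos n u n : ℕ) : ℤ) = ((pos n u a : ℕ) : ℤ) + 1 := by
        rw [← ha, pos_succ]; push_cast; rfl
      have e2 : ((pos n 0 0 : ℕ) : ℤ) = ((pos n a n : ℕ) : ℤ) + 1 - 1 - (pos n n 0 : ℕ) + 1 := by
        rw [h]; simp [pos]
      simp [e1, e2]

theorem reach_rows (h1 : c.T1 = matTape n A) (h2 : c.T2 = matTape n A₀) {u : ℕ}
    (hu : u < n) (s : P.SweepState) :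
    Reach (n * (2 * n + 3) + pos n n 0) (sweepConf c n u 0 0 s)
      (sweepConf c n (u + 1) 0 0 (loop (fun a => loop (body A₀ A u a) n) n s)) := by
  have cols : ∀ k < n, Reach (k * (2 * n + 3)) (sweepConf c n u 0 0 s)
      (sweepConf c n u k 0 (loop (fun a => loop (body A₀ A u a) n) k s)) := by
    intro k
    induction k with
    | zero => exact fun _ => (Reach.refl _).mono (by omega)
    | succ k ih =>
      intro hk
      refine (((ih (by omega)).trans (reach_row h1 h2 hu (by omega) _)).trans
        (reach_next_column h1 h2 hu hk _)).mono ?_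
      rw [Nat.add_one_mul k]
      omega
  obtain ⟨m, rfl⟩ : ∃ m, n = m + 1 := ⟨n - 1, by omega⟩
  refine (((cols m (by omega)).trans (reach_row h1 h2 hu (by omega) _)).trans
    (reach_next_row h1 h2 hu rfl _)).mono ?_
  rw [Nat.add_one_mul m]
  omega

theorem reach_sweep (h1 : c.T1 = matTape n A) (h2 : c.T2 = matTape n A₀) :
    Reach (n * (n * (2 * n + 3) + pos n n 0)) (sweepConf c n 0 0 0 (A, false, false))
      (sweepConf c n n 0 0 (sweep n A₀ A)) := by
  have rows : ∀ k ≤ n, Reach (k * (n * (2 * n + 3) + pos n n 0))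
      (sweepConf c n 0 0 0 (A, false, false)) (sweepConf c n k 0 0
        (loop (fun u => loop (fun a => loop (body A₀ A u a) n) n) k (A, false, false))) := by
    intro k
    induction k with
    | zero => exact fun _ => (Reach.refl _).mono (by omega)
    | succ k ih =>
      intro hk
      refine ((ih (by omega)).trans (reach_rows h1 h2 (by omega) _)).mono ?_
      rw [Nat.add_one_mul k]
  exact rows n le_rfl

/-- The start of a sweep. -/
def sweepStart (c : P.Conf) (n : ℕ) (A : ℕ → ℕ → P.Cell) : P.Conf :=
  sweepConf { c with T1 := matTape n A } n 0 0 0 (A, false, false)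

/-- The old matrix on tape 1 is irrelevant because it is overwritten; tape 1 need only be blank
around it. -/
theorem reach_restart (c : P.Conf) (n : ℕ) (A : ℕ → ℕ → P.Cell) (bad : Bool)
    (hT : ∀ z, z < 0 ∨ (pos n n 0 : ℤ) ≤ z → c.T1 z = .blank) :
    Reach (pos n n 0 + 2) (sweepConf c n n 0 0 (A, true, bad)) (sweepStart c n A) := by
  refine Reach.head (step_inner_changed rfl (hT _ (Or.inr le_rfl))) ?_
  have e : ∀ i : ℕ, i < pos n n 0 →
      ((pos n n 0 : ℕ) : ℤ) - 1 - i = (pos n n 0 - 1 - i : ℕ) := fun i hi => by omega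
  have := reach_copy (c := { sweepConf c n n 0 0 (A, true, bad) with
      q := .copy, h1 := (pos n n 0 : ℤ) - 1, h3 := (pos n n 0 : ℤ) - 1 }) (pos n n 0) rfl rfl
    (fun i hi => by
      dsimp only [sweepConf]
      rw [e i hi]
      exact matTape_ne_blank _ (by omega))
    (tape_of_neg (by dsimp only [sweepConf]; omega)) (by
      intro z hz
      dsimp only [sweepConf] at hz ⊢
      rw [hT z (by omega)]
      rcases (by omega : z < 0 ∨ (pos n n 0 : ℤ) ≤ z) with h | h
      · exact (tape_of_neg h).symm
      · exact (tape_of_ge h).symm)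
  convert this using 1
  · rfl
  · simp [sweepStart, sweepConf, pos]

theorem reach_sweepStart_of_changed (h2 : c.T2 = matTape n A₀)
    (hch : (sweep n A₀ A).2.1 = true) :
    Reach (n * (n * (2 * n + 3) + pos n n 0) + (pos n n 0 + 2)) (sweepStart c n A)
      (sweepStart c n (sweep n A₀ A).1) := by
  refine (reach_sweep (c := { c with T1 := matTape n A }) rfl h2).trans ?_
  have := reach_restart { c with T1 := matTape n A } n (sweep n A₀ A).1 (sweep n A₀ A).2.2 (by
    rintro z (h | h)
    · exact tape_of_neg h
    · exact tape_of_ge h)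
  rwa [← hch] at this

theorem reach_halt_of_unchanged (h2 : c.T2 = matTape n A₀)
    (hch : (sweep n A₀ A).2.1 = false) :
    ∃ c' : P.Conf, c'.q = .halt (!(sweep n A₀ A).2.2) ∧
      Reach (n * (n * (2 * n + 3) + pos n n 0) + 1) (sweepStart c n A) c' := by
  refine ⟨_, ?_, (reach_sweep (c := { c with T1 := matTape n A }) rfl h2).trans
    (Reach.single (step_inner_unchanged (bad := (sweep n A₀ A).2.2) ?_ (tape_of_ge le_rfl)))⟩
  · rfl
  · simp [sweepConf, hch]

end SweepSpec

namespace SweepSpec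

variable {t : ℕ} {P : SweepSpec t}

/-! #### Reading the input -/

/-- The tape `T` contains the encoding of an instance of size `n` with distinguished nodes `x` and
`y` and relations `rel`. -/
structure IsInput (T : ℤ → P.Sym) (n x y : ℕ) (rel : ℕ → ℕ → Fin t → Bool) : Prop where
  x_lt : x < n
  y_lt : y < n
  size : ∀ i : ℕ, i < n → T i = .bit true
  size_end : T n = .bit false
  fst : ∀ i : ℕ, i < x → T ((n + 1 : ℕ) + i) = .bit true
  fst_end : T ((n + 1 : ℕ) + x) = .bit false
  snd : ∀ i : ℕ, i < y → T ((n + x + 2 : ℕ) + i) = .bit true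
  snd_end : T ((n + x + 2 : ℕ) + y) = .bit false
  rels : ∀ i < n, ∀ j < n, ∀ k : Fin t,
    T ((n + x + y + 3 + (i * n + j) * t : ℕ) + (k : ℕ)) = .bit (rel i j k)

/-- The initial matrix. -/
def initMatrix (n x y : ℕ) (rel : ℕ → ℕ → Fin t → Bool) (g : ℕ → P.Guess) (i j : ℕ) : P.Cell :=
  P.initCell (rel i j) (decide (j = i)) (decide (j = x)) (decide (j = y)) (g (i * n + j))

/-- The ruler when the entry in row `i` and column `j` is about to be written. -/
def ruler (x y i j c : ℕ) : P.Sym :=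
  -- The diagonal mark is on tick `i` up to column `i`, on no tick at `j = i + 1`, where it is
  -- pending in the state, and afterwards on tick `i + 1` if the ruler has one.
  .tick (decide (c = x)) (decide (c = y)) (decide ((c = i ∧ j ≤ i) ∨ (c = i + 1 ∧ i + 1 < j)))

theorem tape_zero (F : ℕ → P.Sym) : tape F 0 = fun _ => .blank := by
  funext z
  exact if_neg (by omega)

variable {c : P.Conf} {n x y : ℕ} {rel : ℕ → ℕ → Fin t → Bool}

theorem reach_ticks (hT : ∀ i : ℕ, i < n → c.T0 i = .bit true) (hn : c.T0 n = .bit false)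
    (hq : c.q = .ticks true) (h0 : c.h0 = 0) (h5 : c.h5 = 0)
    (hT5 : c.T5 = fun _ => .blank) :
    Reach (2 * n + 2) c { c with
      q := .markX
      h0 := (n + 1 : ℕ)
      h5 := 0
      T5 := tape (fun i => .tick false false (decide (i = 0))) n } := by
  have main : ∀ k ≤ n, Reach k c { c with
      q := .ticks (decide (k = 0))
      h0 := k
      h5 := k
      T5 := tape (fun i => .tick false false (decide (i = 0))) k } := by
    intro k
    induction k with
    | zero =>
      intro _
      convert Reach.refl c using 1
      rw [Conf.ext_iff]
      simp [hq, h0, h5, hT5, tape_zero]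
    | succ k ih =>
      intro hk
      refine (ih (by omega)).trans (Reach.single ?_)
      rw [step_ticks_bit (c := { c with
        q := .ticks (decide (k = 0))
        h0 := k
        h5 := k
        T5 := tape (fun i => .tick false false (decide (i = 0))) k }) rfl (hT k hk)]
      simp only [Conf.mk.injEq]
      simp [update_tape_length]
  have hs := step_ticks_end (c := { c with
      q := .ticks (decide (n = 0))
      h0 := n
      h5 := n
      T5 := tape (fun i => .tick false false (decide (i = 0))) n }) rfl hn
  have hr := reach_rewind (c := { c with
      q := .rewind 0
      h0 := (n : ℤ) + 1
      h5 := (n : ℤ) - 1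
      T5 := tape (fun i => .tick false false (decide (i = 0))) n }) n rfl
    (fun i hi => ⟨false, false, decide (n - 1 - i = 0), by
      have : (n : ℤ) - 1 - i = (n - 1 - i : ℕ) := by omega
      dsimp only
      rw [this, tape_natCast (by omega)]⟩) (by
      dsimp only
      exact tape_of_neg (by omega))
  refine ((main n le_rfl).trans (Reach.head hs ?_)).mono (by omega : n + (n + 1 + 1) ≤ _)
  convert hr using 1
  simp

theorem reach_marks (hx : x < n) (hy : y < n)
    (hfst : ∀ i : ℕ, i < x → c.T0 ((n + 1 : ℕ) + i) = .bit true)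
    (hfst' : c.T0 ((n + 1 : ℕ) + x) = .bit false)
    (hsnd : ∀ i : ℕ, i < y → c.T0 ((n + x + 2 : ℕ) + i) = .bit true)
    (hsnd' : c.T0 ((n + x + 2 : ℕ) + y) = .bit false)
    (hq : c.q = .markX) (h0 : c.h0 = (n + 1 : ℕ)) (h5 : c.h5 = 0)
    (hT5 : c.T5 = tape (fun i => .tick false false (decide (i = 0))) n) :
    Reach (4 * n) c { c with
      q := .build 0 (fun _ => false) false
      h0 := (n + x + y + 3 : ℕ)
      h5 := 0
      T5 := tape (ruler x y 0 0) n } := by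
  have r1 := reach_markX (c := c) x hq (fun i hi => by rw [h0]; exact hfst i hi)
  have s1 := step_markX_end (c := { c with h0 := c.h0 + x, h5 := c.h5 + x })
    (x := false) (y := false) (d := decide (x = 0)) hq (by rw [h0]; exact hfst')
    (by rw [h5, zero_add, hT5]; exact tape_natCast hx)
  have e1 : Function.update c.T5 (x : ℤ) (.tick true false (decide (x = 0))) =
      tape (fun i => .tick (decide (i = x)) false (decide (i = 0))) n := by
    rw [hT5, update_tape hx]
    refine tape_congr fun k _ => ?_
    by_cases hk : k = x
    · subst hk; simp
    · simp [hk]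
  simp only [h0, h5, zero_add, e1] at r1 s1
  have r2 := reach_rewind (c := { c with
      q := .rewind 1
      h0 := ((n + 1 : ℕ) : ℤ) + x + 1
      h5 := (x : ℤ) - 1
      T5 := tape (fun i => .tick (decide (i = x)) false (decide (i = 0))) n }) x rfl
    (fun i hi => ⟨decide (x - 1 - i = x), false, decide (x - 1 - i = 0), by
      have : (x : ℤ) - 1 - i = (x - 1 - i : ℕ) := by omega
      dsimp only
      rw [this, tape_natCast (by omega)]⟩) (by
      dsimp only
      exact tape_of_neg (by omega))
  have f1 : ((n + 1 : ℕ) : ℤ) + x + 1 = (n + x + 2 : ℕ) := by push_cast; ring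
  have f2 : (x : ℤ) - 1 - x + 1 = 0 := by ring
  simp only [f1, f2] at s1 r2
  have r3 := reach_markY (c := { c with
      q := .markY
      h0 := (n + x + 2 : ℕ)
      h5 := 0
      T5 := tape (fun i => .tick (decide (i = x)) false (decide (i = 0))) n }) y rfl hsnd
  have s3 := step_markY_end (c := { c with
      q := .markY
      h0 := (n + x + 2 : ℕ) + (y : ℤ)
      h5 := y
      T5 := tape (fun i => .tick (decide (i = x)) false (decide (i = 0))) n })
    (x := decide (y = x)) (y := false) (d := decide (y = 0)) rfl hsnd'
    (by dsimp only; rw [tape_natCast hy])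
  have e3 : Function.update (tape (P := P) (fun i => .tick (decide (i = x)) false (decide (i = 0))) n)
      (y : ℤ) (.tick (decide (y = x)) true (decide (y = 0))) = tape (ruler x y 0 0) n := by
    rw [update_tape hy]
    refine tape_congr fun k _ => ?_
    unfold ruler
    by_cases hk : k = y
    · subst hk; simp
    · simp [hk]
  have f3 : ((n + x + 2 : ℕ) : ℤ) + y + 1 = (n + x + y + 3 : ℕ) := by push_cast; ring
  simp only [e3, f3] at s3
  have r4 := reach_rewind (c := { c with
      q := .rewind 2
      h0 := (n + x + y + 3 : ℕ)
      h5 := (y : ℤ) - 1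
      T5 := tape (ruler x y 0 0) n }) y rfl
    (fun i hi => ⟨_, _, _, by
      have : (y : ℤ) - 1 - i = (y - 1 - i : ℕ) := by omega
      dsimp only
      rw [this, tape_natCast (by omega)]
      rfl⟩) (tape_of_neg (by dsimp only; omega))
  have f4 : (y : ℤ) - 1 - y + 1 = 0 := by ring
  simp only [f4] at r4
  simp only [zero_add] at r3
  exact (((r1.trans (Reach.head s1 r2)).trans (r3.trans (Reach.head s3 r4)))).mono (by omega)

/-- The configuration when the entry in row `i` and column `j` is about to be written. -/
def buildConf (c : P.Conf) (n x y : ℕ) (rel : ℕ → ℕ → Fin t → Bool) (g : ℕ → P.Guess)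
    (i j : ℕ) : P.Conf :=
  { c with
    q := .build 0 (fun _ => false) (decide (j = i + 1))
    h0 := (n + x + y + 3 + (i * n + j) * t : ℕ)
    h1 := pos n i j
    h2 := pos n i j
    h3 := pos n i j
    h4 := c.h4 + (i * n + j : ℕ)
    h5 := j
    T1 := tape (entry n (initMatrix n x y rel g)) (pos n i j)
    T2 := tape (entry n (initMatrix n x y rel g)) (pos n i j)
    T3 := tape (entry n (initMatrix n x y rel g)) (pos n i j)
    T5 := tape (ruler x y i j) n }

variable {g : ℕ → P.Guess}

theorem update_ruler {i j : ℕ} (hj : j < n) :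
    Function.update (tape (P := P) (ruler x y i j) n) (j : ℤ)
      (.tick (decide (j = x)) (decide (j = y)) (decide (j = i + 1))) =
      tape (ruler x y i (j + 1)) n := by
  rw [update_tape hj]
  refine tape_congr fun k _ => ?_
  unfold ruler
  by_cases hk : k = j
  · subst hk
    have : ((k = i ∧ k + 1 ≤ i) ∨ (k = i + 1 ∧ i + 1 < k + 1)) ↔ k = i + 1 := by omega
    simp only [Function.update_self, this]
  · have : ((k = i ∧ j + 1 ≤ i) ∨ (k = i + 1 ∧ i + 1 < j + 1)) ↔
        ((k = i ∧ j ≤ i) ∨ (k = i + 1 ∧ i + 1 < j)) := by omega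
    rw [Function.update_of_ne hk]
    simp only [this]

theorem reach_build_entry (hT : IsInput c.T0 n x y rel)
    (hg : ∀ k, g k = (c.T4 (c.h4 + (k : ℕ))).toGuess) {i j : ℕ} (hi : i < n) (hj : j < n) :
    Reach (t + 1) (buildConf c n x y rel g i j) (buildConf c n x y rel g i (j + 1)) := by
  have h5 : (buildConf c n x y rel g i j).T5 (buildConf c n x y rel g i j).h5 =
      .tick (decide (j = x)) (decide (j = y)) (decide (j = i)) := by
    simp only [buildConf, tape_natCast hj, ruler]
    have : ((j = i ∧ j ≤ i) ∨ (j = i + 1 ∧ i + 1 < j)) ↔ j = i := by omega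
    simp only [this]
  have := reach_build_cell (c := buildConf c n x y rel g i j) (rel i j) rfl h5
    (hT.rels i hi j hj)
  have key : entry n (initMatrix n x y rel g) (pos n i j) =
      .cell (P.initCell (rel i j) (decide (j = i)) (decide (j = x)) (decide (j = y))
        ((c.T4 (c.h4 + (i * n + j : ℕ))).toGuess)) := by
    rw [entry_pos _ hj, initMatrix, hg]
  have hrul := update_ruler (P := P) (x := x) (y := y) (i := i) hj
  convert this using 1
  rw [Conf.ext_iff]
  have ht : n + x + y + 3 + (i * n + (j + 1)) * t = n + x + y + 3 + (i * n + j) * t + t := by ring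
  simp only [buildConf, pos_succ, update_tape_length key, hrul]
  refine ⟨by simp, by rw [ht]; push_cast; rfl, by simp, by simp, by simp, by push_cast; ring,
    by simp, trivial, trivial, trivial, trivial, trivial, trivial⟩

theorem reach_build_next_row {i : ℕ} (hi : i + 1 < n) :
    Reach (n + 2) (buildConf c n x y rel g i n) (buildConf c n x y rel g (i + 1) 0) := by
  have hs := step_build_row (c := buildConf c n x y rel g i n) (k := 0) (v := fun _ => false)
    (by simp only [buildConf]; rw [decide_eq_false (by omega)]) (tape_of_ge le_rfl)
  have hr := reach_rewind (c := { buildConf c n x y rel g i n with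
      q := .rewind 2
      h1 := (pos n i n : ℤ) + 1
      h2 := (pos n i n : ℤ) + 1
      h3 := (pos n i n : ℤ) + 1
      h5 := (n : ℤ) - 1
      T1 := tape (entry n (initMatrix n x y rel g)) (pos n i n + 1)
      T2 := tape (entry n (initMatrix n x y rel g)) (pos n i n + 1)
      T3 := tape (entry n (initMatrix n x y rel g)) (pos n i n + 1) }) n rfl
    (fun k hk => ⟨_, _, _, by
      have : (n : ℤ) - 1 - k = (n - 1 - k : ℕ) := by omega
      dsimp only [buildConf]
      rw [this, tape_natCast (by omega)]
      rfl⟩) (tape_of_neg (by dsimp only; omega))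
  refine Reach.head hs ?_
  have hrul : tape (P := P) (ruler x y i n) n = tape (ruler x y (i + 1) 0) n := by
    refine tape_congr fun k hk => ?_
    unfold ruler
    have : ((k = i ∧ n ≤ i) ∨ (k = i + 1 ∧ i + 1 < n)) ↔
        ((k = i + 1 ∧ 0 ≤ i + 1) ∨ (k = i + 1 + 1 ∧ i + 1 + 1 < 0)) := by omega
    simp only [this]
  have hsep : Function.update (tape (P := P) (entry n (initMatrix n x y rel g)) (pos n i n))
      (pos n i n : ℤ) .sep = tape (entry n (initMatrix n x y rel g)) (pos n i n + 1) :=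
    update_tape_length (entry_pos_last _)
  convert hr using 1
  · rw [Conf.ext_iff]
    simp only [buildConf, hsep]
    simp
  · rw [Conf.ext_iff]
    simp only [buildConf, hrul, pos_succ_zero]
    have e : (i + 1) * n + 0 = i * n + n := by ring
    rw [e]
    simp

theorem reach_build_end {i : ℕ} (hi : i + 1 = n) :
    Reach (pos n n 0 + 2) (buildConf c n x y rel g i n)
      (sweepConf { buildConf c n x y rel g i n with
          T1 := matTape n (initMatrix n x y rel g)
          T2 := matTape n (initMatrix n x y rel g) } n n 0 0
        (initMatrix n x y rel g, true, false)) := by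
  have hs := step_build_end (c := buildConf c n x y rel g i n) (k := 0) (v := fun _ => false)
    (by simp only [buildConf]; rw [decide_eq_true hi.symm]) (tape_of_ge le_rfl)
  have hN : pos n n 0 = pos n i n + 1 := by rw [← pos_succ_zero, hi]
  have hsep : Function.update (tape (P := P) (entry n (initMatrix n x y rel g)) (pos n i n))
      (pos n i n : ℤ) .sep = matTape n (initMatrix n x y rel g) := by
    rw [matTape, hN]
    exact update_tape_length (entry_pos_last _)
  have hr := reach_matBack (c := { buildConf c n x y rel g i n with
      q := .matBack true false
      h1 := (pos n i n : ℤ) + 1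
      h3 := (pos n i n : ℤ) + 1
      T1 := matTape n (initMatrix n x y rel g)
      T2 := matTape n (initMatrix n x y rel g)
      T3 := matTape n (initMatrix n x y rel g) }) (pos n n 0) rfl
    (fun k hk => by
      have : (pos n i n : ℤ) - k = (pos n i n - k : ℕ) := by omega
      dsimp only [buildConf]
      rw [this]
      exact matTape_ne_blank _ (by omega))
    (tape_of_neg (by dsimp only [buildConf]; omega))
  refine Reach.head hs ?_
  convert hr using 1
  · rw [Conf.ext_iff]
    simp only [buildConf, hsep]
    simp
  · rw [Conf.ext_iff]
    simp only [buildConf, sweepConf, hN]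
    simp [pos]

theorem reach_build (hT : IsInput c.T0 n x y rel)
    (hg : ∀ k, g k = (c.T4 (c.h4 + (k : ℕ))).toGuess) :
    ∃ c' : P.Conf, c'.T2 = matTape n (initMatrix n x y rel g) ∧
      Reach (n * (n * (t + 1) + n + 2) + 2 * pos n n 0 + 4) (buildConf c n x y rel g 0 0)
        (sweepStart c' n (initMatrix n x y rel g)) := by
  have row : ∀ i < n, ∀ k ≤ n, Reach (k * (t + 1)) (buildConf c n x y rel g i 0)
      (buildConf c n x y rel g i k) := by
    intro i hi k
    induction k with
    | zero => exact fun _ => (Reach.refl _).mono (by omega)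
    | succ k ih =>
      intro hk
      refine ((ih (by omega)).trans (reach_build_entry hT hg hi hk)).mono ?_
      rw [Nat.add_one_mul k]
  have rows : ∀ k < n, Reach (k * (n * (t + 1) + n + 2)) (buildConf c n x y rel g 0 0)
      (buildConf c n x y rel g k 0) := by
    intro k
    induction k with
    | zero => exact fun _ => (Reach.refl _).mono (by omega)
    | succ k ih =>
      intro hk
      refine ((ih (by omega)).trans ((row k (by omega) n le_rfl).trans
        (reach_build_next_row hk))).mono ?_
      rw [Nat.add_one_mul k]
      omega
  have hn : 0 < n := hT.x_lt.trans_le' (Nat.zero_le _)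
  obtain ⟨m, rfl⟩ : ∃ m, n = m + 1 := ⟨n - 1, by omega⟩
  have h1 := ((rows m (by omega)).trans (row m (by omega) (m + 1) le_rfl)).trans
    (reach_build_end rfl)
  refine ⟨_, ?_, (h1.trans (reach_restart _ _ _ _ ?_)).mono ?_⟩
  · rfl
  · rintro z (h | h)
    · exact tape_of_neg h
    · exact tape_of_ge h
  · have := Nat.add_one_mul m ((m + 1) * (t + 1) + (m + 1) + 2)
    omega

theorem reach_sweepStart (hT : IsInput c.T0 n x y rel)
    (hg : ∀ k, g k = (c.T4 (c.h4 + (k : ℕ))).toGuess) (hq : c.q = .ticks true)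
    (h0 : c.h0 = 0) (h1 : c.h1 = 0) (h2 : c.h2 = 0) (h3 : c.h3 = 0) (h5 : c.h5 = 0)
    (hT1 : c.T1 = fun _ => .blank) (hT2 : c.T2 = fun _ => .blank) (hT3 : c.T3 = fun _ => .blank)
    (hT5 : c.T5 = fun _ => .blank) :
    ∃ c' : P.Conf, c'.T2 = matTape n (initMatrix n x y rel g) ∧
      Reach (n * (n * (t + 1) + n + 2) + 2 * pos n n 0 + 4 + (6 * n + 2)) c
        (sweepStart c' n (initMatrix n x y rel g)) := by
  obtain ⟨c', h2', hr⟩ := reach_build (c := c) hT hg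
  have r1 := reach_ticks hT.size hT.size_end hq h0 h5 hT5
  have r2 := reach_marks (c := { c with
      q := .markX
      h0 := (n + 1 : ℕ)
      h5 := 0
      T5 := tape (fun i => .tick false false (decide (i = 0))) n }) hT.x_lt hT.y_lt hT.fst
    hT.fst_end hT.snd hT.snd_end rfl rfl rfl rfl
  refine ⟨c', h2', ((r1.trans r2).trans ?_).mono (by omega :
    2 * n + 2 + 4 * n + (n * (n * (t + 1) + n + 2) + 2 * pos n n 0 + 4) ≤ _)⟩
  convert hr using 1
  rw [Conf.ext_iff]
  simp [buildConf, h1, h2, h3, hT1, hT2, hT3, pos, tape_zero]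

end SweepSpec

namespace SweepSpec

variable {t : ℕ} {P : SweepSpec t}

/-! #### The nondeterministic Turing machine -/

/-- The actions of an instruction as a function of the tape. -/
def Instr.toTrans (I : P.Instr) : State t × (Fin 6 → P.Sym × HeadMove) :=
  (I.state, ![I.a0, I.a1, I.a2, I.a3, I.a4, I.a5])

variable (P) in
/-- The machine writes an arbitrary certificate from right to left on its fifth tape and then works
deterministically. -/
noncomputable def machine : NTM where
  State := State t
  Symbol := P.Sym
  workTapes := 5
  blank := .blank
  input := .bit
  input_injective _ _ h := by simpa using h
  input_ne_blank _ := by simp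
  start := .guess
  accept := .halt true
  trans q s :=
    {r | (q = .guess ∧ ∃ g : P.Sym, r = Instr.toTrans
        ⟨.guess, (s 0, .stay), (s 1, .stay), (s 2, .stay), (s 3, .stay), (g, .left),
          (s 5, .stay)⟩) ∨
      -- This alternative is also available in the guessing state, where it ends the guessing.
      r = Instr.toTrans (P.next q (s 0) (s 1) (s 2) (s 3) (s 4) (s 5))}

/-- The machine configuration described by `c`. -/
noncomputable def Conf.toCfg (c : P.Conf) : P.machine.Cfg where
  state := c.q
  head := ![c.h0, c.h1, c.h2, c.h3, c.h4, c.h5]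
  tape := ![c.T0, c.T1, c.T2, c.T3, c.T4, c.T5]

/-- Write one symbol of the certificate. -/
def Conf.guessStep (c : P.Conf) (g : P.Sym) : P.Conf :=
  { c with h4 := c.h4 - 1, T4 := Function.update c.T4 c.h4 g }

theorem step_toCfg_iff {c : P.Conf} {d : P.machine.Cfg} :
    P.machine.Step c.toCfg d ↔
      (c.q = .guess ∧ ∃ g, d = (c.guessStep g).toCfg) ∨ d = c.step.toCfg := by
  have key : ∀ I : P.Instr, ∀ d : P.machine.Cfg,
      (d = { state := I.toTrans.1
             head := fun i => c.toCfg.head i + (I.toTrans.2 i).2.shift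
             tape := fun i => Function.update (c.toCfg.tape i) (c.toCfg.head i)
              (I.toTrans.2 i).1 }) ↔
      d = Conf.toCfg
        ⟨I.state, c.h0 + I.a0.2.shift, c.h1 + I.a1.2.shift, c.h2 + I.a2.2.shift,
          c.h3 + I.a3.2.shift, c.h4 + I.a4.2.shift, c.h5 + I.a5.2.shift,
          Function.update c.T0 c.h0 I.a0.1, Function.update c.T1 c.h1 I.a1.1,
          Function.update c.T2 c.h2 I.a2.1, Function.update c.T3 c.h3 I.a3.1,
          Function.update c.T4 c.h4 I.a4.1, Function.update c.T5 c.h5 I.a5.1⟩ := by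
    intro I d
    have : ({ state := I.toTrans.1
              head := fun i => c.toCfg.head i + (I.toTrans.2 i).2.shift
              tape := fun i => Function.update (c.toCfg.tape i) (c.toCfg.head i)
                (I.toTrans.2 i).1 } : P.machine.Cfg) = Conf.toCfg
        ⟨I.state, c.h0 + I.a0.2.shift, c.h1 + I.a1.2.shift, c.h2 + I.a2.2.shift,
          c.h3 + I.a3.2.shift, c.h4 + I.a4.2.shift, c.h5 + I.a5.2.shift,
          Function.update c.T0 c.h0 I.a0.1, Function.update c.T1 c.h1 I.a1.1,
          Function.update c.T2 c.h2 I.a2.1, Function.update c.T3 c.h3 I.a3.1,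
          Function.update c.T4 c.h4 I.a4.1, Function.update c.T5 c.h5 I.a5.1⟩ := by
      refine NTM.Cfg.ext rfl ?_ ?_
      · funext i
        change Fin 6 at i
        fin_cases i <;> rfl
      · funext i
        change Fin 6 at i
        fin_cases i <;> rfl
    rw [this]
  have hstep : ∀ d : P.machine.Cfg, _ ↔ d = c.step.toCfg := key c.instr
  have hguess : ∀ g, (c.guessStep g).toCfg = Conf.toCfg (P := P)
      ⟨c.q, c.h0 + 0, c.h1 + 0, c.h2 + 0, c.h3 + 0, c.h4 + -1, c.h5 + 0,
        Function.update c.T0 c.h0 (c.T0 c.h0), Function.update c.T1 c.h1 (c.T1 c.h1),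
        Function.update c.T2 c.h2 (c.T2 c.h2), Function.update c.T3 c.h3 (c.T3 c.h3),
        Function.update c.T4 c.h4 g, Function.update c.T5 c.h5 (c.T5 c.h5)⟩ := by
    intro g
    simp [Conf.guessStep, Int.sub_eq_add_neg]
  constructor
  · rintro ⟨r, ⟨hq, g, rfl⟩ | rfl, hd⟩
    · left
      have hq : c.q = .guess := hq
      refine ⟨hq, g, ?_⟩
      rw [hguess, hq]
      exact (key _ d).1 hd
    · right
      exact (hstep d).1 hd
  · rintro (⟨hq, g, hd⟩ | hd)
    · rw [hguess, hq] at hd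
      exact ⟨_, Or.inl ⟨hq, g, rfl⟩, (key ⟨.guess, (c.T0 c.h0, .stay), (c.T1 c.h1, .stay),
        (c.T2 c.h2, .stay), (c.T3 c.h3, .stay), (g, .left), (c.T5 c.h5, .stay)⟩ d).2 hd⟩
    · exact ⟨_, Or.inr rfl, (hstep d).2 hd⟩

/-- Nondeterminism is confined to the guessing state. As it is never entered again, a run is
deterministic once it has left this state. -/
theorem step_q_ne_guess {c : P.Conf} (h : c.q ≠ .guess) : c.step.q ≠ .guess := by
  change (P.next c.q _ _ _ _ _ _).state ≠ .guess
  generalize c.q = q at h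
  generalize c.T0 c.h0 = s0
  generalize c.T1 c.h1 = s1
  generalize c.T2 c.h2 = s2
  generalize c.T3 c.h3 = s3
  generalize c.T4 c.h4 = s4
  generalize c.T5 c.h5 = s5
  cases q with
  | guess => exact absurd rfl h
  | rewind k =>
    cases s5 <;> fin_cases k <;> simp [next]
  | build k v p =>
    simp only [next]
    split
    · split
      · split <;> simp
      · simp
    · split <;> simp
  | inner ch bad =>
    simp only [next]
    split
    · split <;> simp
    · split <;> simp
  | ticks f => cases s0 with
    | bit b => cases b <;> simp [next]
    | _ => simp [next]
  | markX => cases s0 with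
    | bit b => cases b <;> cases s5 <;> simp [next]
    | _ => cases s5 <;> simp [next]
  | markY => cases s0 with
    | bit b => cases b <;> cases s5 <;> simp [next]
    | _ => cases s5 <;> simp [next]
  | decide ch bad => cases s1 <;> simp [next]
  | rowBack ch bad => cases s3 <;> simp [next]
  | matBack ch bad => cases s2 <;> simp [next]
  | copy => cases s3 <;> simp [next]
  | halt b => simp [next]

theorem reaches_toCfg {c : P.Conf} {m : ℕ} {d : P.machine.Cfg} (hq : c.q ≠ .guess)
    (h : P.machine.Reaches m c.toCfg d) : d = (Conf.step^[m] c).toCfg := by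
  induction m generalizing c with
  | zero =>
    cases h
    rfl
  | succ m ih =>
    cases h with
    | step hs hr =>
      rcases step_toCfg_iff.1 hs with ⟨hq', _⟩ | rfl
      · exact absurd hq' hq
      · exact ih (step_q_ne_guess hq) hr

theorem reaches_iterate (c : P.Conf) (m : ℕ) :
    P.machine.Reaches m c.toCfg (Conf.step^[m] c).toCfg := by
  induction m generalizing c with
  | zero => exact .refl _
  | succ m ih => exact .step (step_toCfg_iff.2 (Or.inr rfl)) (ih _)

theorem iterate_step_of_halt {c : P.Conf} {b : Bool} (h : c.q = .halt b) (m : ℕ) :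
    Conf.step^[m] c = c := Function.iterate_fixed (step_halt h) m

/-- The configuration with input `w` in which the certificate tape is `T` and its head is on
cell `h`. -/
def startConf (q : State t) (w : List Bool) (h : ℤ) (T : ℤ → P.Sym) : P.Conf where
  q := q
  h0 := 0
  h1 := 0
  h2 := 0
  h3 := 0
  h4 := h
  h5 := 0
  T0 z := if 0 ≤ z then (w[z.toNat]?).elim .blank .bit else .blank
  T1 _ := .blank
  T2 _ := .blank
  T3 _ := .blank
  T4 := T
  T5 _ := .blank

theorem init_eq_toCfg (w : List Bool) :
    P.machine.init w = (startConf .guess w 0 fun _ => .blank : P.Conf).toCfg := by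
  refine NTM.Cfg.ext rfl ?_ ?_
  · funext i
    change Fin 6 at i
    fin_cases i <;> rfl
  · funext i z
    change Fin 6 at i
    have hne : ∀ j : Fin 6, j ≠ 0 → (P.machine.init w).tape j z = .blank :=
      fun j hj => if_neg fun h => hj h.1
    fin_cases i
    · change (if (0 : Fin 6) = 0 ∧ 0 ≤ z then _ else _) = (if 0 ≤ z then _ else _)
      simp only [true_and]
      rfl
    all_goals exact hne _ (by decide)

theorem step_startConf_guess (w : List Bool) (h : ℤ) (T : ℤ → P.Sym) :
    (startConf .guess w h T).step = startConf (.ticks true) w (h + 1) T := by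
  simp [Conf.step, Conf.instr, next, startConf, HeadMove.shift]

theorem reaches_guess {w : List Bool} {m : ℕ} {h : ℤ} {T : ℤ → P.Sym} {d : P.machine.Cfg}
    (hr : P.machine.Reaches m (startConf .guess w h T).toCfg d) :
    d.state = .guess ∨ ∃ h' T' m', P.machine.Reaches m'
      (startConf (.ticks true) w h' T').toCfg d := by
  induction m generalizing h T with
  | zero =>
    cases hr
    exact Or.inl rfl
  | succ m ih =>
    cases hr with
    | step hs hr =>
      rcases step_toCfg_iff.1 hs with ⟨_, g, rfl⟩ | rfl
      · exact ih hr
      · rw [step_startConf_guess] at hr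
        exact Or.inr ⟨_, _, _, hr⟩

theorem reaches_trans {M : NTM} {m k : ℕ} {c d e : M.Cfg} (h : M.Reaches m c d)
    (h' : M.Reaches k d e) : M.Reaches (m + k) c e := by
  induction h with
  | refl c => rwa [zero_add]
  | step hs _ ih =>
    rw [Nat.add_right_comm]
    exact .step hs (ih h')

/-- Since the head moves left, the last symbol of `l` is written first and the head of the list
last, in accordance with the induction on `l`. -/
theorem exists_reaches_certificate (w : List Bool) (l : List P.Sym) :
    ∃ h T, (∀ k : ℕ, k < l.length → l[k]? = some (T (h + k))) ∧
      P.machine.Reaches (l.length + 1) (P.machine.init w)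
        (startConf (.ticks true) w h T).toCfg := by
  have main : ∃ h T, (∀ k : ℕ, k < l.length → l[k]? = some (T (h + 1 + k))) ∧
      P.machine.Reaches l.length (P.machine.init w) (startConf .guess w h T).toCfg := by
    induction l with
    | nil =>
      refine ⟨0, fun _ => .blank, fun k hk => absurd hk (by simp), ?_⟩
      rw [init_eq_toCfg]
      exact .refl _
    | cons g l ih =>
      obtain ⟨h, T, hT, hr⟩ := ih
      refine ⟨h - 1, Function.update T h g, ?_, ?_⟩
      · intro k hk
        rw [sub_add_cancel]
        rcases k with _ | k
        · simp
        · rw [Function.update_of_ne (by push_cast; omega)]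
          rw [List.getElem?_cons_succ, hT k (by simpa using hk)]
          congr 2
          push_cast
          ring
      · exact reaches_trans hr (.step (step_toCfg_iff.2 (Or.inl ⟨rfl, g, rfl⟩)) (.refl _))
  obtain ⟨h, T, hT, hr⟩ := main
  refine ⟨h + 1, T, hT, reaches_trans hr ?_⟩
  rw [← step_startConf_guess]
  exact reaches_iterate _ 1

/-- An accepting run must leave the guessing state and is deterministic from then on. Halting
configurations are fixed points, so this run and the run provided by `hv` end in the same
configuration, and the verdict is `true`. -/
theorem exists_of_acceptsIn {w : List Bool} {v : ℤ → (ℤ → P.Sym) → Bool}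
    (hv : ∀ h T, ∃ (B : ℕ) (c : P.Conf), Reach B (startConf (.ticks true) w h T) c ∧
      c.q = .halt (v h T)) {n : ℕ} (hacc : P.machine.AcceptsIn w n) :
    ∃ h T, v h T = true := by
  obtain ⟨d, hr, hd⟩ := hacc
  rw [init_eq_toCfg] at hr
  rcases reaches_guess hr with hg | ⟨h, T, m, hr⟩
  · rw [hd] at hg
    exact absurd hg (by simp [machine])
  · refine ⟨h, T, ?_⟩
    obtain ⟨B, c, ⟨k, _, rfl⟩, hc⟩ := hv h T
    have hdm := reaches_toCfg (by simp [startConf]) hr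
    have hm : (Conf.step^[m] (startConf (.ticks true) w h T)).q = .halt true := by
      rw [hdm] at hd
      exact hd
    have e1 := iterate_step_of_halt hm k
    have e2 := iterate_step_of_halt hc m
    rw [← Function.iterate_add_apply] at e1 e2
    rw [add_comm k m, e2] at e1
    rw [e1, hm] at hc
    simpa using hc.symm

theorem acceptsIn_of_reach {w : List Bool} {l : List P.Sym} {h : ℤ} {T : ℤ → P.Sym} {B : ℕ}
    {c : P.Conf} (hl : P.machine.Reaches (l.length + 1) (P.machine.init w)
      (startConf (.ticks true) w h T).toCfg)
    (hr : Reach B (startConf (.ticks true) w h T) c) (hc : c.q = .halt true) :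
    ∃ n ≤ l.length + 1 + B, P.machine.AcceptsIn w n := by
  obtain ⟨m, hm, rfl⟩ := hr
  exact ⟨_, Nat.add_le_add_left hm _, _, reaches_trans hl (reaches_iterate _ m), hc⟩

/-! #### Encoded instances -/

theorem getElem?_flatMap_of_length {α β : Type} {f : α → List β} {m : ℕ} :
    ∀ (l : List α), (∀ a ∈ l, (f a).length = m) → ∀ {i j : ℕ}, j < m → ∀ {a : α},
      l[i]? = some a → (l.flatMap f)[i * m + j]? = (f a)[j]?
  | [], _, i, j, _, a, h => by simp at h
  | b :: l, hf, 0, j, hj, a, h => by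
    have hb := hf b (by simp)
    simp only [List.getElem?_cons_zero, Option.some.injEq] at h
    subst h
    rw [List.flatMap_cons, Nat.zero_mul, zero_add, List.getElem?_append_left (by omega)]
  | b :: l, hf, i + 1, j, hj, a, h => by
    have hb := hf b (by simp)
    rw [List.flatMap_cons, List.getElem?_append_right (by rw [Nat.add_one_mul]; omega), hb]
    rw [show (i + 1) * m + j - m = i * m + j by rw [Nat.add_one_mul]; omega]
    exact getElem?_flatMap_of_length l (fun a ha => hf a (by simp [ha])) hj (by simpa using h)

/-- The relations of an instance, extended by `false`. -/
def relBits (I : EvalInstance t) (i j : ℕ) (k : Fin t) : Bool :=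
  if h : i < I.n ∧ j < I.n then I.rel ⟨i, h.1⟩ ⟨j, h.2⟩ k else false

theorem length_matrixBits (I : EvalInstance t) (i : Fin I.n) :
    ((List.finRange I.n).flatMap fun j => (List.finRange t).map fun a => I.rel i j a).length =
      I.n * t := by
  simp [List.length_flatMap]

theorem getElem?_matrixBits (I : EvalInstance t) {i j : ℕ} (hi : i < I.n) (hj : j < I.n)
    (k : Fin t) :
    ((List.finRange I.n).flatMap fun i => (List.finRange I.n).flatMap fun j =>
      (List.finRange t).map fun a => I.rel i j a)[(i * I.n + j) * t + k]? =
        some (relBits I i j k) := by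
  have hjt : j * t + k < I.n * t := by
    have := Nat.mul_le_mul_right t (Nat.succ_le_of_lt hj)
    rw [Nat.succ_mul] at this
    omega
  rw [show (i * I.n + j) * t + k = i * (I.n * t) + (j * t + k) by ring,
    getElem?_flatMap_of_length _ (fun a _ => length_matrixBits I a) hjt (a := ⟨i, hi⟩)
      (by simp [hi]),
    getElem?_flatMap_of_length (m := t) _ (fun a _ => by simp) k.2 (a := ⟨j, hj⟩) (by simp [hj])]
  simp [relBits, hi, hj]

theorem isInput_encode (I : EvalInstance t) (h : ℤ) (T : ℤ → P.Sym) :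
    IsInput (startConf (.ticks true) I.encode h T).T0 I.n I.x I.y (relBits I) := by
  have read : ∀ (k : ℕ) (b : Bool), I.encode[k]? = some b →
      (startConf (.ticks true) I.encode h T).T0 (k : ℤ) = .bit b := by
    intro k b hk
    simp [startConf, hk]
  refine ⟨I.x.2, I.y.2, fun i hi => read _ _ ?_, read _ _ ?_, fun i hi => ?_, ?_, fun i hi => ?_,
    ?_, fun i hi j hj k => ?_⟩
  · simp [EvalInstance.encode, EvalInstance.unary, List.getElem?_append, hi]
  · simp [EvalInstance.encode, EvalInstance.unary]
  · rw [← Nat.cast_add]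
    refine read _ _ ?_
    have := I.x.2
    simp only [EvalInstance.encode, EvalInstance.unary, List.append_assoc, List.getElem?_append,
      List.length_replicate, List.length_singleton]
    grind
  · rw [← Nat.cast_add]
    refine read _ _ ?_
    simp only [EvalInstance.encode, EvalInstance.unary, List.append_assoc, List.getElem?_append,
      List.length_replicate, List.length_singleton]
    grind
  · rw [← Nat.cast_add]
    refine read _ _ ?_
    simp only [EvalInstance.encode, EvalInstance.unary, List.append_assoc, List.getElem?_append,
      List.length_replicate, List.length_singleton]
    grind
  · rw [← Nat.cast_add]
    refine read _ _ ?_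
    simp only [EvalInstance.encode, EvalInstance.unary, List.append_assoc, List.getElem?_append,
      List.length_replicate, List.length_singleton]
    grind
  · rw [← Nat.cast_add]
    refine read _ _ ?_
    rw [EvalInstance.encode, List.getElem?_append_right (by simp [EvalInstance.unary]; omega)]
    rw [← getElem?_matrixBits I hi hj k]
    congr 1
    simp [EvalInstance.unary]
    omega

end SweepSpec

/-! ### NP membership by iterating sweeps up to stability -/

namespace SweepSpec

variable {t : ℕ} {P : SweepSpec t}

/-- The matrix after `k` sweeps. -/
noncomputable def sweeps (n : ℕ) (A₀ : ℕ → ℕ → P.Cell) (k : ℕ) : ℕ → ℕ → P.Cell :=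
  (fun A => (sweep n A₀ A).1)^[k] A₀

theorem sweeps_succ (n : ℕ) (A₀ : ℕ → ℕ → P.Cell) (k : ℕ) :
    sweeps n A₀ (k + 1) = (sweep n A₀ (sweeps n A₀ k)).1 :=
  Function.iterate_succ_apply' _ _ _

theorem reach_sweeps {n : ℕ} {A₀ : ℕ → ℕ → P.Cell} {c : P.Conf} (h2 : c.T2 = matTape n A₀) (k : ℕ)
    (h : ∀ i < k, (sweep n A₀ (sweeps n A₀ i)).2.1 = true) :
    Reach (k * (n * (n * (2 * n + 3) + pos n n 0) + (pos n n 0 + 2))) (sweepStart c n A₀)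
      (sweepStart c n (sweeps n A₀ k)) := by
  induction k with
  | zero => exact (Reach.refl _).mono (by omega)
  | succ k ih =>
    rw [sweeps_succ, Nat.add_one_mul]
    exact (ih fun i hi => h i (by omega)).trans
      (reach_sweepStart_of_changed h2 (h k (by omega)))

/-- A problem is in NP if it can be decided by guessing a matrix and repeating sweeps until they do
not change the matrix any more, provided that the number of sweeps is quadratic. -/
theorem inNP_of_sweeps (P : SweepSpec t) (m : ℕ) (good : EvalInstance t → (ℕ → P.Guess) → Prop)
    (hcongr : ∀ I g g', (∀ k < I.n * I.n, g k = g' k) → good I g → good I g')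
    (hsweep : ∀ I g, ∃ k ≤ m * (I.n * I.n),
      (∀ i < k, (sweep I.n (initMatrix I.n I.x I.y (relBits I) g)
        (sweeps I.n (initMatrix I.n I.x I.y (relBits I) g) i)).2.1 = true) ∧
      (sweep I.n (initMatrix I.n I.x I.y (relBits I) g)
        (sweeps I.n (initMatrix I.n I.x I.y (relBits I) g) k)).2.1 = false ∧
      ((sweep I.n (initMatrix I.n I.x I.y (relBits I) g)
        (sweeps I.n (initMatrix I.n I.x I.y (relBits I) g) k)).2.2 = false ↔ good I g)) :
    InNP EvalInstance.encode fun I => ∃ g, good I g := by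
  classical
  -- Time for reading the input and building the matrix, for at most `m * (n * n)` sweeps with
  -- changes including their restarts, and for the final sweep without changes.
  let B : ℕ → ℕ := fun n => n * (n * (t + 1) + n + 2) + 2 * (n * (n + 1)) + 4 + (6 * n + 2) +
    (m * (n * n) * (n * (n * (2 * n + 3) + n * (n + 1)) + (n * (n + 1) + 2)) +
      (n * (n * (2 * n + 3) + n * (n + 1)) + 1))
  have hv : ∀ I h T, ∃ c : P.Conf, Reach (B I.n) (startConf (.ticks true) I.encode h T) c ∧
      c.q = .halt (decide (good I fun k : ℕ => (T (h + k)).toGuess)) := by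
    intro I h T
    obtain ⟨c, h2, hr⟩ := reach_sweepStart (isInput_encode I h T)
      (g := fun k : ℕ => (T (h + k)).toGuess) (fun k => rfl) rfl rfl rfl rfl rfl rfl rfl rfl rfl rfl
    obtain ⟨k, hk, h3, h4, h5⟩ := hsweep I fun k : ℕ => (T (h + k)).toGuess
    obtain ⟨d, hd, hr'⟩ := reach_halt_of_unchanged h2 h4
    refine ⟨d, ((hr.trans (reach_sweeps h2 k h3)).trans hr').mono ?_, ?_⟩
    · have hp : pos I.n I.n 0 = I.n * (I.n + 1) := rfl
      have := Nat.mul_le_mul_right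
        (I.n * (I.n * (2 * I.n + 3) + I.n * (I.n + 1)) + (I.n * (I.n + 1) + 2)) hk
      simp only [hp, B]
      omega
    · rw [hd]
      congr 1
      rw [Bool.eq_iff_iff, decide_eq_true_iff, ← h5]
      simp
  have hn : ∀ I : EvalInstance t, I.n ≤ I.encode.length := fun I => by
    simp [EvalInstance.encode, EvalInstance.unary]
  -- `X * X + 1` accounts for writing the certificate, the rest is `B`. The polynomial is evaluated
  -- at the length of the encoding, which is at least `I.n`.
  open Polynomial in
  refine ⟨P.machine, X * X + 1 + (X * (X * C (t + 1) + X + 2) + 2 * (X * (X + 1)) + 4 +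
    (6 * X + 2) + (C m * (X * X) * (X * (X * (2 * X + 3) + X * (X + 1)) +
      (X * (X + 1) + 2)) + (X * (X * (2 * X + 3) + X * (X + 1)) + 1))), fun I => ?_⟩
  have hcomplete : (∃ g, good I g) → ∃ n ≤ I.n * I.n + 1 + B I.n,
      P.machine.AcceptsIn I.encode n := by
    rintro ⟨g, hg⟩
    obtain ⟨h, T, hT, hr⟩ := exists_reaches_certificate (P := P) I.encode
      ((List.range (I.n * I.n)).map fun k => .guess (g k))
    obtain ⟨c, hc, hq⟩ := hv I h T
    -- Only the first `n²` cells are known to agree with `g`, hence the need for `hcongr`.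
    have hgood : good I fun k : ℕ => (T (h + k)).toGuess := by
      refine hcongr I g _ (fun k hk => ?_) hg
      have := hT k (by simpa using hk)
      simp only [List.getElem?_map, List.getElem?_range hk, Option.map_some,
        Option.some.injEq] at this
      rw [← this]
      rfl
    rw [decide_eq_true hgood] at hq
    simpa using acceptsIn_of_reach hr hc hq
  refine ⟨⟨fun h => ?_, ?_⟩, fun h => ?_⟩
  · obtain ⟨n, -, hn⟩ := hcomplete h
    exact ⟨n, hn⟩
  · rintro ⟨n, hacc⟩
    obtain ⟨h, T, hgood⟩ := exists_of_acceptsIn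
      (v := fun h T => decide (good I fun k : ℕ => (T (h + k)).toGuess))
      (fun h T => ⟨B I.n, hv I h T⟩) hacc
    exact ⟨_, of_decide_eq_true hgood⟩
  · obtain ⟨k, hk, hacc⟩ := hcomplete h
    refine ⟨k, hk.trans ?_, hacc⟩
    have := hn I
    simp only [Polynomial.eval_add, Polynomial.eval_mul, Polynomial.eval_X, Polynomial.eval_C,
      Polynomial.eval_one, Polynomial.eval_ofNat, B]
    gcongr

/-- An induction principle for sweeps: `J S s` says that `s` is a possible state when the triples
in `S` have been processed. -/
theorem sweep_induction {n : ℕ} {A₀ A : ℕ → ℕ → P.Cell}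
    {J : Set (ℕ × ℕ × ℕ) → P.SweepState → Prop} (h0 : J ∅ (A, false, false))
    (hJ : ∀ S s, ∀ u < n, ∀ a < n, ∀ b < n, J S s →
      J (insert (u, a, b) S) (body A₀ A u a b s)) :
    J {p | p.1 < n ∧ p.2.1 < n ∧ p.2.2 < n} (sweep n A₀ A) := by
  have h1 : ∀ S s, ∀ u < n, ∀ a < n, J S s → ∀ k ≤ n,
      J (S ∪ {p | p.1 = u ∧ p.2.1 = a ∧ p.2.2 < k}) (loop (body A₀ A u a) k s) := by
    intro S s u hu a ha hs k
    induction k with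
    | zero => intro _; simpa [loop] using hs
    | succ k ih =>
      intro hk
      convert hJ _ _ u hu a ha k (by omega) (ih (by omega)) using 1
      · ext ⟨u', a', b'⟩
        simp only [Set.mem_union, Set.mem_insert_iff, Prod.mk.injEq]
        change (_ ∨ (u' = u ∧ a' = a ∧ b' < k + 1)) ↔ (_ ∨ _ ∨ (u' = u ∧ a' = a ∧ b' < k))
        grind
      · rfl
  have h2 : ∀ S s, ∀ u < n, J S s → ∀ k ≤ n,
      J (S ∪ {p | p.1 = u ∧ p.2.1 < k ∧ p.2.2 < n})
        (loop (fun a => loop (body A₀ A u a) n) k s) := by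
    intro S s u hu hs k
    induction k with
    | zero => intro _; simpa [loop] using hs
    | succ k ih =>
      intro hk
      convert h1 _ _ u hu k (by omega) (ih (by omega)) n le_rfl using 1
      · ext ⟨u', a', b'⟩
        change (_ ∨ (u' = u ∧ a' < k + 1 ∧ b' < n)) ↔
          ((_ ∨ (u' = u ∧ a' < k ∧ b' < n)) ∨ (u' = u ∧ a' = k ∧ b' < n))
        grind
      · rfl
  have h3 : ∀ k ≤ n, J {p | p.1 < k ∧ p.2.1 < n ∧ p.2.2 < n}
      (loop (fun u => loop (fun a => loop (body A₀ A u a) n) n) k (A, false, false)) := by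
    intro k
    induction k with
    | zero => intro _; simpa [loop] using h0
    | succ k ih =>
      intro hk
      convert h2 _ _ k (by omega) (ih (by omega)) n le_rfl using 1
      · ext ⟨u', a', b'⟩
        change (u' < k + 1 ∧ a' < n ∧ b' < n) ↔
          ((u' < k ∧ a' < n ∧ b' < n) ∨ (u' = k ∧ a' < n ∧ b' < n))
        grind
      · rfl
  exact h3 n le_rfl

end SweepSpec

/-! ### Sweeps that compute reachability -/

section BlockSpec

variable {σ S : Type} {t K : ℕ}

/-- An entry of the matrix that describes a database given by blocks: the bits of the input, the
position relative to the diagonal and the distinguished nodes, the edges, and the nodes and states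
reached so far. -/
@[ext]
structure BlockCell (σ S : Type) (t K : ℕ) where
  bits : Fin t → Bool
  diag : Bool
  atX : Bool
  atY : Bool
  edges : Set (Fin (K + 1) × σ × Fin (K + 1))
  reach : Set (Fin (K + 1) × Fin (K + 1) × S)

instance [Finite σ] [Finite S] : Finite (BlockCell σ S t K) :=
  Finite.of_injective
    (fun l : BlockCell σ S t K => (l.bits, l.diag, l.atX, l.atY, l.edges, l.reach)) (by
      intro l l' h
      simp only [Prod.mk.injEq] at h
      obtain ⟨h1, h2, h3, h4, h5, h6⟩ := h
      exact BlockCell.ext h1 h2 h3 h4 h5 h6)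

/-- Extend reached nodes and states by one edge. -/
def stepReach (δ : S → σ → S) (r : Set (Fin (K + 1) × Fin (K + 1) × S))
    (e : Set (Fin (K + 1) × σ × Fin (K + 1))) : Set (Fin (K + 1) × Fin (K + 1) × S) :=
  {p | ∃ l q c, (p.1, l, q) ∈ r ∧ (l, c, p.2.1) ∈ e ∧ p.2.2 = δ q c}

/-- The condition on the final entries `l₁` at `(u, a)` and `l₃` at `(u, b)`. -/
def BlockCell.Consistent (acc : Option (Fin t) → Set S) (pol : Bool)
    (l₁ l₃ : BlockCell σ S t K) : Prop :=
  -- Only nodes with index `0` belong to the instance; no pair involving another node may be an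
  -- answer of a view.
  (∀ j k l, (∃ q ∈ acc (some j), (k, l, q) ∈ l₃.reach) ↔ k = 0 ∧ l = 0 ∧ l₃.bits j = true) ∧
  -- For `l₁` at `(u, a)` and `l₃` at `(u, b)` this means `u = a = x` and `b = y`. The entry `l₃`
  -- alone does not reveal whether its row is `x`.
  (l₁.diag = true → l₁.atX = true → l₃.atY = true →
    ((∃ q ∈ acc none, (0, 0, q) ∈ l₃.reach) ↔ pol = true))

open Classical in
/-- The rules for computing reachability in a guessed database given by blocks, together with the
states of an automaton, and for comparing the answers of the views with the input. -/
noncomputable def blockSpec [Finite σ] [Finite S] (δ : S → σ → S) (s₀ : S)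
    (acc : Option (Fin t) → Set S) (pol : Bool) (K : ℕ) : SweepSpec t where
  Cell := BlockCell σ S t K
  Guess := Set (Fin (K + 1) × σ × Fin (K + 1))
  noGuess := ∅
  initCell v d x y g := ⟨v, d, x, y, g, {p | d = true ∧ p.1 = p.2.1 ∧ p.2.2 = s₀}⟩
  upd l₁ l₂ l₃ := { l₃ with reach := l₃.reach ∪ stepReach δ l₁.reach l₂.edges }
  bad l₁ _ l₃ := decide ¬ l₁.Consistent acc pol l₃

variable {δ : S → σ → S} {s₀ : S} {acc : Option (Fin t) → Set S} {pol : Bool}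
  {n x y : ℕ} {rel : ℕ → ℕ → Fin t → Bool}
  {g : ℕ → Set (Fin (K + 1) × σ × Fin (K + 1))}

variable (σ K) in
/-- The matrix in which the reached nodes and states are given by `R`. -/
def reachMatrix (n x y : ℕ) (rel : ℕ → ℕ → Fin t → Bool)
    (g : ℕ → Set (Fin (K + 1) × σ × Fin (K + 1)))
    (R : ℕ → ℕ → Set (Fin (K + 1) × Fin (K + 1) × S)) (i j : ℕ) : BlockCell σ S t K :=
  ⟨rel i j, decide (j = i), decide (j = x), decide (j = y), g (i * n + j), R i j⟩

theorem setCell_reachMatrix (R : ℕ → ℕ → Set (Fin (K + 1) × Fin (K + 1) × S)) (u b : ℕ)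
    (r : Set (Fin (K + 1) × Fin (K + 1) × S)) :
    SweepSpec.setCell (reachMatrix σ K n x y rel g R) u b
      { reachMatrix σ K n x y rel g R u b with reach := r } =
      reachMatrix σ K n x y rel g (SweepSpec.setCell R u b r) := by
  funext i j
  rw [SweepSpec.setCell_apply]
  simp only [reachMatrix]
  rw [SweepSpec.setCell_apply]
  split_ifs with h
  · obtain ⟨rfl, rfl⟩ := h
    rfl
  · rfl

/-- The database given by a sequence of guesses. -/
def guessedDB (n K : ℕ) (g : ℕ → Set (Fin (K + 1) × σ × Fin (K + 1))) : GraphDB σ :=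
  GraphDB.ofBlocks n K fun i j => g (i * n + j)

/-- All triples in `R` come from paths. -/
def SoundReach (δ : S → σ → S) (s₀ : S) (n : ℕ) (g : ℕ → Set (Fin (K + 1) × σ × Fin (K + 1)))
    (R : ℕ → ℕ → Set (Fin (K + 1) × Fin (K + 1) × S)) : Prop :=
  ∀ u < n, ∀ b < n, ∀ k l q, (k, l, q) ∈ R u b →
    ∃ w, (guessedDB n K g).Path (u + n * k) w (b + n * l) ∧ w.foldl δ s₀ = q

/-- The set `R u b` is closed under extending paths by an edge. -/
def ClosedReach (δ : S → σ → S) (n : ℕ) (g : ℕ → Set (Fin (K + 1) × σ × Fin (K + 1)))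
    (R : ℕ → ℕ → Set (Fin (K + 1) × Fin (K + 1) × S)) : Prop :=
  ∀ u < n, ∀ a < n, ∀ b < n, stepReach δ (R u a) (g (a * n + b)) ⊆ R u b

/-- Closure under appending one edge suffices for completeness, by induction on the word from its
end. -/
theorem mem_reach_iff {R : ℕ → ℕ → Set (Fin (K + 1) × Fin (K + 1) × S)}
    (hR : SoundReach δ s₀ n g R) (hcl : ClosedReach δ n g R)
    (hinit : ∀ u k, (k, k, s₀) ∈ R u u) {u b : ℕ} (hu : u < n) (hb : b < n)
    {k l : Fin (K + 1)} {q : S} :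
    (k, l, q) ∈ R u b ↔
      ∃ w, (guessedDB n K g).Path (u + n * k) w (b + n * l) ∧ w.foldl δ s₀ = q := by
  refine ⟨hR u hu b hb k l q, ?_⟩
  rintro ⟨w, p, rfl⟩
  induction w using List.reverseRecOn generalizing b l with
  | nil =>
    obtain ⟨h, _⟩ := GraphDB.path_nil_iff.1 p
    obtain ⟨rfl, rfl⟩ := GraphDB.block_inj hu hb h
    exact hinit u k
  | append_singleton w c ih =>
    obtain ⟨z, p', he⟩ := p.exists_of_snoc
    obtain ⟨a, ha, l', rfl⟩ := GraphDB.mem_nodes_ofBlocks.1 p'.right_mem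
    refine hcl u hu a ha b hb ⟨l', _, c, ih ha p', (GraphDB.edge_ofBlocks ha hb).1 he, ?_⟩
    simp

theorem consistent_iff_realizes {V : Fin t → RegularExpression σ} {Q : RegularExpression σ}
    (hV : ∀ j w, w ∈ (V j).matches' ↔ w.foldl δ s₀ ∈ acc (some j))
    (hQ : ∀ w, w ∈ Q.matches' ↔ w.foldl δ s₀ ∈ acc none) (I : EvalInstance t)
    {R : ℕ → ℕ → Set (Fin (K + 1) × Fin (K + 1) × S)}
    (hR : SoundReach δ s₀ I.n g R) (hcl : ClosedReach δ I.n g R)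
    (hinit : ∀ u k, (k, k, s₀) ∈ R u u) :
    (∀ u < I.n, ∀ a < I.n, ∀ b < I.n,
      (reachMatrix σ K I.n I.x I.y (SweepSpec.relBits I) g R u a).Consistent acc pol
        (reachMatrix σ K I.n I.x I.y (SweepSpec.relBits I) g R u b)) ↔
      GraphDB.Realizes V Q I.db I.x I.y pol (guessedDB I.n K g) := by
  have hedge : ∀ j u v, I.db.edge j u v ↔ u < I.n ∧ v < I.n ∧
      SweepSpec.relBits I u v j = true := by
    intro j u v
    constructor
    · rintro ⟨i, i', rfl, rfl, h⟩
      simpa [SweepSpec.relBits] using h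
    · rintro ⟨hu, hv, h⟩
      rw [SweepSpec.relBits, dif_pos ⟨hu, hv⟩] at h
      exact ⟨⟨u, hu⟩, ⟨v, hv⟩, rfl, rfl, h⟩
  have hview : ∀ u < I.n, ∀ b < I.n, ∀ (k l : Fin (K + 1)) j,
      (∃ q ∈ acc (some j), (k, l, q) ∈ R u b) ↔
        (u + I.n * k, b + I.n * l) ∈ (rpq (V j)).ans (guessedDB I.n K g) := by
    intro u hu b hb k l j
    simp only [mem_reach_iff hR hcl hinit hu hb]
    constructor
    · rintro ⟨q, hq, w, p, rfl⟩
      exact ⟨w, (hV j w).2 hq, p⟩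
    · rintro ⟨w, hw, p⟩
      exact ⟨_, (hV j w).1 hw, w, p, rfl⟩
  have hquery : (∃ q ∈ acc none, (0, 0, q) ∈ R I.x I.y) ↔
      ((I.x : ℕ), (I.y : ℕ)) ∈ (rpq Q).ans (guessedDB I.n K g) := by
    simp only [mem_reach_iff hR hcl hinit I.x.2 I.y.2, Fin.val_zero, mul_zero, add_zero]
    constructor
    · rintro ⟨q, hq, w, p, rfl⟩
      exact ⟨w, (hQ w).2 hq, p⟩
    · rintro ⟨w, hw, p⟩
      exact ⟨_, (hQ w).1 hw, w, p, rfl⟩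
  have hzero : ∀ (u : ℕ) (k : Fin (K + 1)), u + I.n * k < I.n → k = 0 := by
    intro u k h
    by_contra hk
    have h1 : 1 ≤ (k : ℕ) := Nat.one_le_iff_ne_zero.2 fun h => hk (Fin.ext h)
    have := Nat.mul_le_mul_left I.n h1
    omega
  constructor
  · intro H
    refine ⟨fun u hu => ?_, fun j u v => ?_, ?_⟩
    · exact GraphDB.mem_nodes_ofBlocks.2 ⟨u, Finset.mem_range.1 hu, 0, by simp⟩
    · rw [hedge]
      constructor
      · intro h
        have hm := (rpq (V j)).ans_mem _ _ _ h
        obtain ⟨u, hu, k, rfl⟩ := GraphDB.mem_nodes_ofBlocks.1 hm.1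
        obtain ⟨v, hv, l, rfl⟩ := GraphDB.mem_nodes_ofBlocks.1 hm.2
        obtain ⟨rfl, rfl, hb⟩ := ((H u hu u hu v hv).1 j k l).1 ((hview u hu v hv k l j).2 h)
        simpa [hu, hv, reachMatrix] using hb
      · rintro ⟨hu, hv, h⟩
        simpa using (hview u hu v hv 0 0 j).1 (((H u hu u hu v hv).1 j 0 0).2 ⟨rfl, rfl, h⟩)
    · rw [← hquery]
      exact (H _ I.x.2 _ I.x.2 _ I.y.2).2 (by simp [reachMatrix]) (by simp [reachMatrix])
        (by simp [reachMatrix])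
  · intro H u hu a ha b hb
    refine ⟨fun j k l => ?_, fun h1 h2 h3 => ?_⟩
    · refine (hview u hu b hb k l j).trans ?_
      rw [H.view_iff, hedge]
      constructor
      · rintro ⟨h1, h2, h3⟩
        obtain rfl := hzero _ _ h1
        obtain rfl := hzero _ _ h2
        exact ⟨rfl, rfl, by simpa [reachMatrix] using h3⟩
      · rintro ⟨rfl, rfl, h⟩
        simpa [hu, hb, reachMatrix] using h
    · simp only [reachMatrix, decide_eq_true_eq] at h1 h2 h3
      subst h1 h2 h3
      rw [← H.query_iff, ← hquery]
      rfl

variable [Finite σ] [Finite S]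

theorem initMatrix_blockSpec :
    SweepSpec.initMatrix (P := blockSpec δ s₀ acc pol K) n x y rel g =
      reachMatrix σ K n x y rel g fun i j => {p | j = i ∧ p.1 = p.2.1 ∧ p.2.2 = s₀} := by
  funext i j
  simp [SweepSpec.initMatrix, reachMatrix, blockSpec]

/-- As long as nothing has changed, the current sets are still `R`, so all tests so far were made on
one and the same matrix. In an unchanged sweep they add up to closedness of `R` and to consistency
of all its entries. New elements always come from appending an edge to a path, which preserves
soundness. -/
theorem sweep_reachMatrix {R R₀ : ℕ → ℕ → Set (Fin (K + 1) × Fin (K + 1) × S)}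
    (hR : SoundReach δ s₀ n g R) :
    ∃ R', (SweepSpec.sweep (P := blockSpec δ s₀ acc pol K) n (reachMatrix σ K n x y rel g R₀)
        (reachMatrix σ K n x y rel g R)).1 = reachMatrix σ K n x y rel g R' ∧
      (∀ u b, R u b ⊆ R' u b) ∧ SoundReach δ s₀ n g R' ∧
      ((SweepSpec.sweep (P := blockSpec δ s₀ acc pol K) n (reachMatrix σ K n x y rel g R₀)
        (reachMatrix σ K n x y rel g R)).2.1 = false → ClosedReach δ n g R ∧
        ((SweepSpec.sweep (P := blockSpec δ s₀ acc pol K) n (reachMatrix σ K n x y rel g R₀)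
          (reachMatrix σ K n x y rel g R)).2.2 = false ↔ ∀ u < n, ∀ a < n, ∀ b < n,
            (reachMatrix σ K n x y rel g R u a).Consistent acc pol
              (reachMatrix σ K n x y rel g R u b))) ∧
      ((SweepSpec.sweep (P := blockSpec δ s₀ acc pol K) n (reachMatrix σ K n x y rel g R₀)
        (reachMatrix σ K n x y rel g R)).2.1 = true → ∃ u < n, ∃ b < n, R u b ≠ R' u b) := by
  have key := SweepSpec.sweep_induction (P := blockSpec δ s₀ acc pol K) (n := n)
    (A₀ := reachMatrix σ K n x y rel g R₀) (A := reachMatrix σ K n x y rel g R)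
    (J := fun T s => ∃ R', s.1 = reachMatrix σ K n x y rel g R' ∧ (∀ u b, R u b ⊆ R' u b) ∧
      SoundReach δ s₀ n g R' ∧
      (s.2.1 = false → R' = R ∧
        (∀ u a b, (u, a, b) ∈ T → stepReach δ (R u a) (g (a * n + b)) ⊆ R u b) ∧
        (s.2.2 = false ↔ ∀ u a b, (u, a, b) ∈ T →
          (reachMatrix σ K n x y rel g R u a).Consistent acc pol
            (reachMatrix σ K n x y rel g R u b))) ∧
      (s.2.1 = true → ∃ u < n, ∃ b < n, R u b ≠ R' u b))
    ⟨R, rfl, fun _ _ => subset_rfl, hR, fun _ => ⟨rfl, by simp, by simp⟩, by simp⟩ ?_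
  · obtain ⟨R', h1, h2, h3, h4, h5⟩ := key
    refine ⟨R', h1, h2, h3, fun h => ?_, h5⟩
    obtain ⟨-, h6, h7⟩ := h4 h
    exact ⟨fun u hu a ha b hb => h6 u a b ⟨hu, ha, hb⟩,
      h7.trans ⟨fun H u hu a ha b hb => H u a b ⟨hu, ha, hb⟩, fun H u a b h =>
        H u h.1 a h.2.1 b h.2.2⟩⟩
  · rintro T ⟨A, ch, bad⟩ u hu a ha b hb ⟨R', rfl, h2, h3, h4, h5⟩
    have hupd : (blockSpec δ s₀ acc pol K).upd (reachMatrix σ K n x y rel g R u a)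
        (reachMatrix σ K n x y rel g R₀ a b) (reachMatrix σ K n x y rel g R' u b) =
        { reachMatrix σ K n x y rel g R' u b with
          reach := R' u b ∪ stepReach δ (R u a) (g (a * n + b)) } := rfl
    simp only [SweepSpec.body, hupd]
    refine ⟨SweepSpec.setCell R' u b (R' u b ∪ stepReach δ (R u a) (g (a * n + b))),
      setCell_reachMatrix _ _ _ _, ?_, ?_, ?_, ?_⟩
    · intro u' b'
      rw [SweepSpec.setCell_apply]
      split_ifs with h
      · obtain ⟨rfl, rfl⟩ := h
        exact (h2 _ _).trans Set.subset_union_left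
      · exact h2 _ _
    · intro u' hu' b' hb' k l q hm
      rw [SweepSpec.setCell_apply] at hm
      split_ifs at hm with h
      · obtain ⟨rfl, rfl⟩ := h
        rcases hm with hm | ⟨l', q', c, hm, he, hq⟩
        · exact h3 _ hu' _ hb' k l q hm
        · obtain ⟨w, p, hw⟩ := hR _ hu' _ ha _ _ _ hm
          refine ⟨w ++ [c], p.snoc ((GraphDB.edge_ofBlocks ha hb').2 he), ?_⟩
          dsimp only at hq
          simp [hw, hq]
      · exact h3 _ hu' _ hb' k l q hm
    · intro hch
      simp only [Bool.or_eq_false_iff, decide_eq_false_iff_not, not_not] at hch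
      obtain ⟨hch, heq⟩ := hch
      obtain ⟨rfl, h6, h7⟩ := h4 hch
      have hsub : stepReach δ (R' u a) (g (a * n + b)) ⊆ R' u b := by
        have := congrArg BlockCell.reach heq
        exact Set.union_eq_left.1 this
      refine ⟨?_, ?_, ?_⟩
      · rw [Set.union_eq_left.2 hsub]
        funext i j
        rw [SweepSpec.setCell_apply]
        split_ifs with h
        · obtain ⟨rfl, rfl⟩ := h
          rfl
        · rfl
      · rintro u' a' b' (h | h)
        · obtain ⟨rfl, rfl, rfl⟩ : u' = u ∧ a' = a ∧ b' = b := by simpa using h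
          exact hsub
        · exact h6 _ _ _ h
      · rw [Bool.or_eq_false_iff, h7]
        have hbad : (blockSpec δ s₀ acc pol K).bad (reachMatrix σ K n x y rel g R' u a)
            (reachMatrix σ K n x y rel g R₀ a b) (reachMatrix σ K n x y rel g R' u b) = false ↔
            (reachMatrix σ K n x y rel g R' u a).Consistent acc pol
              (reachMatrix σ K n x y rel g R' u b) := by
          simp [blockSpec]
        rw [hbad]
        constructor
        · rintro ⟨h, h'⟩ u' a' b' (h'' | h'')
          · obtain ⟨rfl, rfl, rfl⟩ : u' = u ∧ a' = a ∧ b' = b := by simpa using h''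
            exact h'
          · exact h _ _ _ h''
        · intro h
          exact ⟨fun u' a' b' h' => h _ _ _ (Or.inr h'), h _ _ _ (Or.inl rfl)⟩
    · intro hch
      simp only [Bool.or_eq_true, decide_eq_true_eq] at hch
      -- If this triple adds nothing, the change happened earlier. Otherwise the new elements are
      -- missing from `R u b` as well, because `R u b ⊆ R' u b`.
      by_cases hsub : stepReach δ (R u a) (g (a * n + b)) ⊆ R' u b
      · rcases hch with hch | hch
        · obtain ⟨u', hu', b', hb', hne⟩ := h5 hch
          refine ⟨u', hu', b', hb', ?_⟩
          rw [Set.union_eq_left.2 hsub, SweepSpec.setCell_apply]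
          split_ifs with h
          · obtain ⟨rfl, rfl⟩ := h
            exact hne
          · exact hne
        · exfalso
          refine hch (hupd.trans ?_)
          rw [Set.union_eq_left.2 hsub]
          rfl
      · refine ⟨u, hu, b, hb, fun h => hsub ?_⟩
        rw [SweepSpec.setCell_apply, if_pos ⟨rfl, rfl⟩] at h
        exact Set.subset_union_right.trans (h.symm.subset.trans (h2 u b))

/-- The number of reached nodes and states. -/
noncomputable def reachCount (n : ℕ) (R : ℕ → ℕ → Set (Fin (K + 1) × Fin (K + 1) × S)) : ℕ :=
  ∑ u ∈ Finset.range n, ∑ b ∈ Finset.range n, (R u b).ncard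

theorem reachCount_le (n : ℕ) (R : ℕ → ℕ → Set (Fin (K + 1) × Fin (K + 1) × S)) :
    reachCount n R ≤ Nat.card (Fin (K + 1) × Fin (K + 1) × S) * (n * n) := by
  calc reachCount n R
      ≤ ∑ u ∈ Finset.range n, ∑ b ∈ Finset.range n, Nat.card (Fin (K + 1) × Fin (K + 1) × S) :=
        Finset.sum_le_sum fun u _ => Finset.sum_le_sum fun b _ => Set.ncard_le_card _
    _ = _ := by simp; ring

theorem reachCount_lt {R R' : ℕ → ℕ → Set (Fin (K + 1) × Fin (K + 1) × S)}
    (h : ∀ u b, R u b ⊆ R' u b) (h' : ∃ u < n, ∃ b < n, R u b ≠ R' u b) :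
    reachCount n R < reachCount n R' := by
  obtain ⟨u, hu, b, hb, hne⟩ := h'
  have hle : ∀ u b, (R u b).ncard ≤ (R' u b).ncard := fun u b =>
    Set.ncard_le_ncard (h u b) (Set.toFinite _)
  refine Finset.sum_lt_sum (fun u _ => Finset.sum_le_sum fun b _ => hle u b)
    ⟨u, Finset.mem_range.2 hu, Finset.sum_lt_sum (fun b _ => hle u b)
      ⟨b, Finset.mem_range.2 hb, ?_⟩⟩
  exact Set.ncard_lt_ncard ((h u b).ssubset_of_ne hne) (Set.toFinite _)

/-- Every sweep with changes increases `reachCount`, which is bounded by `reachCount_le`. Hence some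
sweep changes nothing, and the first such sweep comes early enough; its conflict flag decides
whether the guessed database is a realisation. -/
theorem exists_sweeps_blockSpec {V : Fin t → RegularExpression σ} {Q : RegularExpression σ}
    (hV : ∀ j w, w ∈ (V j).matches' ↔ w.foldl δ s₀ ∈ acc (some j))
    (hQ : ∀ w, w ∈ Q.matches' ↔ w.foldl δ s₀ ∈ acc none) (I : EvalInstance t)
    (A₀ : ℕ → ℕ → (blockSpec δ s₀ acc pol K).Cell)
    (hA₀ : A₀ = SweepSpec.initMatrix (P := blockSpec δ s₀ acc pol K) I.n I.x I.y
      (SweepSpec.relBits I) g) :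
    ∃ k ≤ Nat.card (Fin (K + 1) × Fin (K + 1) × S) * (I.n * I.n),
      (∀ i < k, (SweepSpec.sweep I.n A₀ (SweepSpec.sweeps I.n A₀ i)).2.1 = true) ∧
      (SweepSpec.sweep I.n A₀ (SweepSpec.sweeps I.n A₀ k)).2.1 = false ∧
      ((SweepSpec.sweep I.n A₀ (SweepSpec.sweeps I.n A₀ k)).2.2 = false ↔
        GraphDB.Realizes V Q I.db I.x I.y pol (guessedDB I.n K g)) := by
  classical
  let R₀ : ℕ → ℕ → Set (Fin (K + 1) × Fin (K + 1) × S) :=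
    fun i j => {p | j = i ∧ p.1 = p.2.1 ∧ p.2.2 = s₀}
  have hA : A₀ = reachMatrix σ K I.n I.x I.y (SweepSpec.relBits I) g R₀ := by
    rw [hA₀, initMatrix_blockSpec]
  have hsound : SoundReach δ s₀ I.n g R₀ := by
    rintro u hu b hb k l q ⟨h, h', h''⟩
    dsimp only at h h' h''
    subst h h' h''
    exact ⟨[], GraphDB.path_nil_iff.2 ⟨rfl, GraphDB.mem_nodes_ofBlocks.2 ⟨_, hu, _, rfl⟩⟩, rfl⟩
  have main : ∀ k, (∀ i < k, (SweepSpec.sweep I.n A₀ (SweepSpec.sweeps I.n A₀ i)).2.1 = true) →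
      ∃ R, SweepSpec.sweeps I.n A₀ k = reachMatrix σ K I.n I.x I.y (SweepSpec.relBits I) g R ∧
        (∀ u b, R₀ u b ⊆ R u b) ∧ SoundReach δ s₀ I.n g R ∧ k ≤ reachCount I.n R := by
    intro k
    induction k with
    | zero => exact fun _ => ⟨R₀, hA, fun _ _ => subset_rfl, hsound, Nat.zero_le _⟩
    | succ k ih =>
      intro h
      obtain ⟨R, hR, hsub, hs, hc⟩ := ih fun i hi => h i (by omega)
      obtain ⟨R', h1, h2, h3, -, h5⟩ := sweep_reachMatrix (acc := acc) (pol := pol) (x := I.x)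
        (y := I.y) (rel := SweepSpec.relBits I) (R₀ := R₀) hs
      have hk := h k (by omega)
      rw [hR, hA] at hk
      refine ⟨R', ?_, fun u b => (hsub u b).trans (h2 u b), h3, ?_⟩
      · rw [SweepSpec.sweeps_succ, hR]
        nth_rewrite 1 [hA]
        exact h1
      · exact Nat.succ_le_of_lt (hc.trans_lt (reachCount_lt h2 (h5 hk)))
  have hex : ∃ k, (SweepSpec.sweep I.n A₀ (SweepSpec.sweeps I.n A₀ k)).2.1 = false := by
    by_contra hne
    push Not at hne
    obtain ⟨R, -, -, -, hc⟩ := main (Nat.card (Fin (K + 1) × Fin (K + 1) × S) * (I.n * I.n) + 1)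
      fun i _ => by simpa using hne i
    have := hc.trans (reachCount_le I.n R)
    omega
  have hmin : ∀ i < Nat.find hex,
      (SweepSpec.sweep I.n A₀ (SweepSpec.sweeps I.n A₀ i)).2.1 = true := fun i hi => by
    simpa using Nat.find_min hex hi
  obtain ⟨R, hR, hsub, hs, hc⟩ := main _ hmin
  refine ⟨Nat.find hex, hc.trans (reachCount_le I.n R), hmin, Nat.find_spec hex, ?_⟩
  have hspec := Nat.find_spec hex
  obtain ⟨R', -, -, -, h4, -⟩ := sweep_reachMatrix (acc := acc) (pol := pol) (x := I.x)
    (y := I.y) (rel := SweepSpec.relBits I) (R₀ := R₀) hs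
  rw [hR] at hspec ⊢
  nth_rewrite 1 [hA] at hspec
  nth_rewrite 1 [hA]
  obtain ⟨hcl, hbad⟩ := h4 hspec
  rw [hbad]
  exact consistent_iff_realizes hV hQ I hs hcl fun u k => hsub u u ⟨rfl, rfl, rfl⟩

end BlockSpec

/-! ### Assembling the small model argument and the machine -/

theorem guessedDB_congr {σ : Type} {n K : ℕ}
    {g g' : ℕ → Set (Fin (K + 1) × σ × Fin (K + 1))} (h : ∀ k < n * n, g k = g' k) :
    guessedDB n K g = guessedDB n K g' := by
  have hlt : ∀ i < n, ∀ j < n, i * n + j < n * n := by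
    intro i hi j hj
    have := Nat.mul_le_mul_right n (Nat.succ_le_of_lt hi)
    rw [Nat.succ_mul] at this
    omega
  refine GraphDB.ext rfl ?_
  funext c u v
  refine propext ⟨?_, ?_⟩ <;> rintro ⟨i, hi, j, hj, k, l, rfl, rfl, he⟩ <;>
    refine ⟨i, hi, j, hj, k, l, rfl, rfl, ?_⟩
  · exact (congrArg ((k, c, l) ∈ ·) (h _ (hlt i hi j hj))).mp he
  · exact (congrArg ((k, c, l) ∈ ·) (h _ (hlt i hi j hj))).mpr he

theorem ofBlocks_eq_guessedDB {σ : Type} {n K : ℕ}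
    (E : ℕ → ℕ → Set (Fin (K + 1) × σ × Fin (K + 1))) :
    GraphDB.ofBlocks n K E = guessedDB n K fun k => E (k / n) (k % n) := by
  have he : ∀ i j, j < n → E ((i * n + j) / n) ((i * n + j) % n) = E i j := by
    intro i j hj
    rw [mul_comm, Nat.mul_add_div (by omega), Nat.div_eq_of_lt hj, add_zero, Nat.mul_add_mod,
      Nat.mod_eq_of_lt hj]
  refine GraphDB.ext rfl ?_
  funext c u v
  refine propext ⟨?_, ?_⟩ <;> rintro ⟨i, hi, j, hj, k, l, rfl, rfl, h⟩ <;>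
    refine ⟨i, hi, j, hj, k, l, rfl, rfl, ?_⟩
  · dsimp only
    rwa [he i j hj]
  · dsimp only at h
    rwa [he i j hj] at h

/-- Whether a view image is realised by some database with a prescribed answer of `Q` is in NP. -/
theorem inNP_exists_realizes {σ : Type} [Finite σ] {t : ℕ} (V : Fin t → RegularExpression σ)
    (Q : RegularExpression σ) (pol : Bool) :
    InNP EvalInstance.encode fun I : EvalInstance t =>
      ∃ D, GraphDB.Realizes V Q I.db I.x I.y pol D := by
  obtain ⟨S, _, δ, s₀, acc, hacc⟩ := RegularExpression.exists_common_automaton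
    fun i : Option (Fin t) => i.elim Q V
  have hV : ∀ j w, w ∈ (V j).matches' ↔ w.foldl δ s₀ ∈ acc (some j) := fun j w => hacc (some j) w
  have hQ : ∀ w, w ∈ Q.matches' ↔ w.foldl δ s₀ ∈ acc none := fun w => hacc none w
  obtain ⟨K, hK⟩ := GraphDB.exists_blocks_realizes V Q hV hQ
  have hNP := SweepSpec.inNP_of_sweeps (blockSpec δ s₀ acc pol K)
    (Nat.card (Fin (K + 1) × Fin (K + 1) × S))
    (fun I g => GraphDB.Realizes V Q I.db I.x I.y pol (guessedDB I.n K g))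
    (fun I g g' h hg => by rwa [← guessedDB_congr h])
    (fun I g => exists_sweeps_blockSpec hV hQ I _ rfl)
  have heq : (fun I : EvalInstance t => ∃ D, GraphDB.Realizes V Q I.db I.x I.y pol D) =
      fun I => ∃ g, GraphDB.Realizes V Q I.db I.x I.y pol (guessedDB I.n K g) := by
    funext I
    refine propext ⟨fun h => ?_, fun ⟨g, hg⟩ => ⟨_, hg⟩⟩
    obtain ⟨E, hE⟩ := hK I pol h
    rw [ofBlocks_eq_guessedDB] at hE
    exact ⟨_, hE⟩
  rw [heq]
  exact hNP

theorem mainTheorem4 {σ : Type} [Finite σ] {t : ℕ}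
    (V : Fin t → RegularExpression σ) (Q : RegularExpression σ)
    (hdet : View.Determines (fun i => rpq (V i)) (rpq Q)) :
    (∃ R : BinaryQuery (Fin t),
      IsRewriting R (fun i => rpq (V i)) (rpq Q) ∧ R.NPDataComplexity) ∧
    (∃ R : BinaryQuery (Fin t),
      IsRewriting R (fun i => rpq (V i)) (rpq Q) ∧ R.CoNPDataComplexity) := by
  refine ⟨⟨realizationQuery V Q true, isRewriting_realizationQuery hdet true, ?_⟩,
    ⟨realizationQuery V Q false, isRewriting_realizationQuery hdet false, ?_⟩⟩
  · have h : (realizationQuery V Q true).Eval = fun I : EvalInstance t =>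
        ∃ D, GraphDB.Realizes V Q I.db I.x I.y true D := by
      funext I
      simp [eval_realizationQuery]
    unfold BinaryQuery.NPDataComplexity
    rw [h]
    exact inNP_exists_realizes V Q true
  -- For `pol = false` a pair fails to be selected exactly if some realisation makes it a non-answer
  -- of `Q`, so the complement is again a realisation problem.
  · have h : (fun I : EvalInstance t => ¬ (realizationQuery V Q false).Eval I) =
        fun I : EvalInstance t => ∃ D, GraphDB.Realizes V Q I.db I.x I.y false D := by
      funext I
      simp [eval_realizationQuery]
    unfold BinaryQuery.CoNPDataComplexity InCoNP
    rw [h]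
    exact inNP_exists_realizes V Q false
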